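/- \textbf{Edge of the Wedge Theorem.} Let $E \subset \mathbb R^n$ be open and let $C \subset \mathbb R^n$ be an open cone (that is, an open set with $tY \in C$ for all $Y \in C$ and $t>0$) such that $C = -C$. Set $W = E + iC \subset \mathbb C^n$. Let $\mathcal N \subset \mathbb C^n$ be an open set with $\mathcal N \cap \mathbb R^n = E$, and let $f$ be a holomorphic function on $\mathcal N \cap W$. Suppose that $\lim_{C \ni Y \to 0} f(\cdot + iY)$ exists in $\mathcal D'(E)$ and is independent of how $Y \to 0$ in $C$; that is, there is a distribution $u \in \mathcal D'(E)$ such that for every test function $\varphi \in C_c^\infty(E)$ the integrals $\int_E f(x+iY)\,\varphi(x)\,dx$ (which are defined for all sufficiently small $Y \in C$) tend to $u(\varphi)$ as $Y \to 0$, $Y \in C$. Then there are an open set $\mathcal N' \subset \mathcal N$ with $\mathcal N' \cap \mathbb R^n = E$ and a holomorphic function $h$ on $\mathcal N'$ such that $h = f$ on $\mathcal N' \cap W$. -/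

import Mathlib

open Set Filter Topology MeasureTheory TopologicalSpace
open scoped Distributions

namespace EdgeOfWedge

/-- The point `x + iy` of `ℂⁿ`, for `x, y ∈ ℝⁿ`. -/
def toComplex {n : ℕ} (x y : Fin n → ℝ) : Fin n → ℂ :=
  fun j => (x j : ℂ) + (y j : ℂ) * Complex.I

/-- The inclusion `ℝⁿ ⊂ ℂⁿ`. -/
def ofRealVec {n : ℕ} (x : Fin n → ℝ) : Fin n → ℂ :=
  fun j => (x j : ℂ)

/-- The set `E + iC ⊂ ℂⁿ`, for `E, C ⊂ ℝⁿ`. -/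
def wedge {n : ℕ} (E C : Set (Fin n → ℝ)) : Set (Fin n → ℂ) :=
  {z | ∃ x ∈ E, ∃ y ∈ C, z = toComplex x y}

/-- `C` is an open cone in `ℝⁿ`: an open set that is stable under multiplication by positive
reals. -/
structure IsOpenCone {n : ℕ} (C : Set (Fin n → ℝ)) : Prop where
  isOpen : IsOpen C
  smul_mem : ∀ y ∈ C, ∀ t : ℝ, 0 < t → t • y ∈ C

/-- `f(· + iY) → u` in `𝓓'(E)` as `Y → 0` in `C`: for every test function `φ` on `E` the
pairings `∫ φ(x) f(x + iY) dx` tend to `u(φ)`, as `Y` tends to `0` in an arbitrary way inside `C`.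
(If `f` is continuous on `𝒩 ∩ (E + iC)`, with `𝒩` an open set that contains `E`, then for every `φ`
and all small enough `Y ∈ C` the integrand is continuous and supported in a compact subset of `E`
on which `x + iY` stays in `𝒩 ∩ (E + iC)`; other values of `f` do not matter.) -/
def HasDistribBoundaryValue {n : ℕ} (E : Opens (Fin n → ℝ)) (C : Set (Fin n → ℝ))
    (f : (Fin n → ℂ) → ℂ) (u : 𝓓'(E, ℂ)) : Prop :=
  ∀ φ : 𝓓(E, ℝ),
    Tendsto (fun Y : Fin n → ℝ => ∫ x : Fin n → ℝ, (φ x : ℂ) * f (toComplex x Y))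
      (𝓝[C] 0) (𝓝 (u φ))

end EdgeOfWedge

/-! The extension near a real point is given by an explicit average of `f`. Put the point at the
origin and choose a ball of radius `ρ` about `e` inside `C`. For small `w ∈ ℂⁿ` and `κ > 0` consider
the disc `c ↦ (1 - c²) w + κ c e`, with centre `w`. On `|c| = 1` one has `1 - c² = -2i (Im c) c`, so
the imaginary part of the disc is `Im c · (κ e - 2 Re (c w))`: a nonzero multiple of a vector close
to `κ e` when `c ≠ ±1`. Since `C = -C`, the boundary circle lies in the wedge except at `c = ±1`,
for every small `w`, in the wedge or not. The average of `f` over this circle is therefore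
holomorphic in `w` on a full ball, and it remains to see that it returns `f(w)` for `w` in the
wedge.

The circle runs into the edge at `c = ±1`, where `f` may blow up. Uniform boundedness makes the
functions `f(· + iY)` bounded in some fixed order of differentiation, and the mean value property
turns this into a bound `K r ^ (-M)`, with `r` the distance of `Im z` to the boundary of the cone
(`exists_polynomial_growth`). The weight `(1 - c²) ^ M` cancels the blow-up and equals `1` at the
centre (`IsWedgeScale.norm_integrand_le`).

If `f` is continuous up to the edge, then for real `w` the whole disc lies in the closed tube and
meets the edge only for real `c`. Painlevé's theorem and the mean value property show that the
average equals the boundary value, and a one-variable uniqueness argument carries the identity into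
the wedge (`wedgeAverage_eq_of_continuousOn`). In general, mollify `f` in the real directions: the
mollified functions are continuous up to the edge (`exists_continuous_extension`) and share the
growth constants of `f`, so dominated convergence gives the identity for `f`
(`exists_local_extension`). The local extensions agree on overlaps by the identity theorem. -/

namespace EdgeOfWedge

/-! ### Real and imaginary parts, tubes and wedges -/

/-- The vector of real parts of a point of `ℂⁿ`. -/
def reVec {n : ℕ} (z : Fin n → ℂ) : Fin n → ℝ := fun j => (z j).re

/-- The vector of imaginary parts of a point of `ℂⁿ`. -/
def imVec {n : ℕ} (z : Fin n → ℂ) : Fin n → ℝ := fun j => (z j).im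

section Basics

variable {n : ℕ}

@[simp] theorem reVec_toComplex (x y : Fin n → ℝ) : reVec (toComplex x y) = x := by
  ext j; simp [reVec, toComplex]

@[simp] theorem imVec_toComplex (x y : Fin n → ℝ) : imVec (toComplex x y) = y := by
  ext j; simp [imVec, toComplex]

@[simp] theorem toComplex_reVec_imVec (z : Fin n → ℂ) : toComplex (reVec z) (imVec z) = z := by
  ext j; simp [reVec, imVec, toComplex, Complex.re_add_im]

@[simp] theorem reVec_ofRealVec (x : Fin n → ℝ) : reVec (ofRealVec x) = x := by
  ext j; simp [reVec, ofRealVec]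

@[simp] theorem imVec_ofRealVec (x : Fin n → ℝ) : imVec (ofRealVec x) = 0 := by
  ext j; simp [imVec, ofRealVec]

@[simp] theorem reVec_add (z w : Fin n → ℂ) : reVec (z + w) = reVec z + reVec w := by
  ext j; simp [reVec]

@[simp] theorem imVec_add (z w : Fin n → ℂ) : imVec (z + w) = imVec z + imVec w := by
  ext j; simp [imVec]

@[simp] theorem reVec_sub (z w : Fin n → ℂ) : reVec (z - w) = reVec z - reVec w := by
  ext j; simp [reVec]

@[simp] theorem imVec_sub (z w : Fin n → ℂ) : imVec (z - w) = imVec z - imVec w := by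
  ext j; simp [imVec]

@[simp] theorem reVec_smul (c : ℂ) (z : Fin n → ℂ) :
    reVec (c • z) = c.re • reVec z - c.im • imVec z := by
  ext j; simp [reVec, imVec]

@[simp] theorem imVec_smul (c : ℂ) (z : Fin n → ℂ) :
    imVec (c • z) = c.re • imVec z + c.im • reVec z := by
  ext j; simp [reVec, imVec]

@[simp] theorem reVec_zero : reVec (0 : Fin n → ℂ) = 0 := by ext j; simp [reVec]

@[simp] theorem imVec_zero : imVec (0 : Fin n → ℂ) = 0 := by ext j; simp [imVec]

theorem toComplex_zero_right (x : Fin n → ℝ) : toComplex x 0 = ofRealVec x := by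
  ext j; simp [toComplex, ofRealVec]

theorem toComplex_add_toComplex (x y a b : Fin n → ℝ) :
    toComplex x y + toComplex a b = toComplex (x + a) (y + b) := by
  ext j; simp only [toComplex, Pi.add_apply]; push_cast; ring

theorem add_ofRealVec (z : Fin n → ℂ) (t : Fin n → ℝ) :
    z + ofRealVec t = toComplex (reVec z + t) (imVec z) := by
  conv_lhs => rw [← toComplex_reVec_imVec z, ← toComplex_zero_right, toComplex_add_toComplex]
  simp

@[fun_prop] theorem continuous_reVec : Continuous (reVec : (Fin n → ℂ) → Fin n → ℝ) := by
  unfold reVec; fun_prop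

@[fun_prop] theorem continuous_imVec : Continuous (imVec : (Fin n → ℂ) → Fin n → ℝ) := by
  unfold imVec; fun_prop

@[fun_prop] theorem continuous_ofRealVec :
    Continuous (ofRealVec : (Fin n → ℝ) → Fin n → ℂ) := by
  unfold ofRealVec; fun_prop

theorem continuous_toComplex :
    Continuous (fun p : (Fin n → ℝ) × (Fin n → ℝ) => toComplex p.1 p.2) := by
  unfold toComplex; fun_prop

@[fun_prop] theorem continuous_toComplex_comp {α : Type*} [TopologicalSpace α]
    {a b : α → Fin n → ℝ} (ha : Continuous a) (hb : Continuous b) :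
    Continuous (fun p => toComplex (a p) (b p)) :=
  continuous_toComplex.comp (ha.prodMk hb)

theorem norm_reVec_le (z : Fin n → ℂ) : ‖reVec z‖ ≤ ‖z‖ :=
  (pi_norm_le_iff_of_nonneg (norm_nonneg _)).2 fun j =>
    (Complex.abs_re_le_norm (z j)).trans (norm_le_pi_norm z j)

theorem norm_imVec_le (z : Fin n → ℂ) : ‖imVec z‖ ≤ ‖z‖ :=
  (pi_norm_le_iff_of_nonneg (norm_nonneg _)).2 fun j =>
    (Complex.abs_im_le_norm (z j)).trans (norm_le_pi_norm z j)

@[simp] theorem norm_ofRealVec (x : Fin n → ℝ) : ‖ofRealVec x‖ = ‖x‖ := by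
  refine le_antisymm ?_ ?_
  · refine (pi_norm_le_iff_of_nonneg (norm_nonneg _)).2 fun j => ?_
    simpa [ofRealVec] using norm_le_pi_norm x j
  · simpa using norm_reVec_le (ofRealVec x)

theorem norm_toComplex_le (x y : Fin n → ℝ) : ‖toComplex x y‖ ≤ ‖x‖ + ‖y‖ := by
  refine (pi_norm_le_iff_of_nonneg (by positivity)).2 fun j => ?_
  refine (norm_add_le _ _).trans (add_le_add ?_ ?_)
  · simpa using norm_le_pi_norm x j
  · simpa using norm_le_pi_norm y j

/-- The points of `ℝⁿ + iC` whose real and imaginary parts have norm less than `R`. -/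
def tube {n : ℕ} (C : Set (Fin n → ℝ)) (R : ℝ) : Set (Fin n → ℂ) :=
  {z | ‖reVec z‖ < R ∧ ‖imVec z‖ < R ∧ imVec z ∈ C}

theorem isOpen_tube {C : Set (Fin n → ℝ)} (hC : IsOpen C) (R : ℝ) : IsOpen (tube C R) := by
  exact (isOpen_lt continuous_reVec.norm continuous_const).inter
    ((isOpen_lt continuous_imVec.norm continuous_const).inter (hC.preimage continuous_imVec))

theorem tube_mono (C : Set (Fin n → ℝ)) {R R' : ℝ} (h : R ≤ R') : tube C R ⊆ tube C R' :=
  fun _ hz => ⟨hz.1.trans_le h, hz.2.1.trans_le h, hz.2.2⟩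

theorem mem_wedge_iff {E C : Set (Fin n → ℝ)} {z : Fin n → ℂ} :
    z ∈ wedge E C ↔ reVec z ∈ E ∧ imVec z ∈ C := by
  constructor
  · rintro ⟨x, hx, y, hy, rfl⟩; simpa using ⟨hx, hy⟩
  · exact fun h => ⟨_, h.1, _, h.2, by simp⟩

theorem isOpen_wedge {E C : Set (Fin n → ℝ)} (hE : IsOpen E) (hC : IsOpen C) :
    IsOpen (wedge E C) := by
  have : wedge E C = reVec ⁻¹' E ∩ imVec ⁻¹' C := by ext z; exact mem_wedge_iff
  rw [this]
  exact (hE.preimage continuous_reVec).inter (hC.preimage continuous_imVec)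

end Basics

/-! ### One complex variable: Painlevé's theorem and uniqueness from the diameter -/

section OneVariable

/-- Painlevé's theorem: a function that is continuous on a disc and holomorphic off the real axis
is holomorphic. -/
theorem differentiableOn_ball_of_off_real {g : ℂ → ℂ} {r : ℝ}
    (hc : ContinuousOn g (Metric.ball 0 r))
    (hd : ∀ z ∈ Metric.ball (0 : ℂ) r, z.im ≠ 0 → DifferentiableAt ℂ g z) :
    DifferentiableOn ℂ g (Metric.ball 0 r) := by
  -- Morera: it suffices that integrals over boundaries of rectangles vanish. A rectangle that
  -- crosses the real axis is cut along it, and Cauchy's theorem applies to each half because only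
  -- continuity is needed on the boundary.
  refine (Complex.isConservativeOn_and_continuousOn_iff_isDifferentiableOn Metric.isOpen_ball).1
    ⟨?_, hc⟩
  intro z w hzw
  rw [← add_eq_zero_iff_eq_neg, Complex.wedgeIntegral_add_wedgeIntegral_eq]
  have key : ∀ a b : ℝ, uIcc a b ⊆ uIcc z.im w.im → (0 : ℝ) ∉ Ioo (min a b) (max a b) →
      (∫ x : ℝ in z.re..w.re, g (x + a * Complex.I)) -
      (∫ x : ℝ in z.re..w.re, g (x + b * Complex.I)) +
      Complex.I • (∫ y : ℝ in a..b, g (w.re + y * Complex.I)) -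
      Complex.I • (∫ y : ℝ in a..b, g (z.re + y * Complex.I)) = 0 := by
    intro a b hab h0
    have hsub : uIcc z.re w.re ×ℂ uIcc a b ⊆ Metric.ball 0 r := fun p hp =>
      hzw ⟨hp.1, hab hp.2⟩
    have := Complex.integral_boundary_rect_eq_zero_of_continuousOn_of_differentiableOn g
      (⟨z.re, a⟩ : ℂ) (⟨w.re, b⟩ : ℂ) (hc.mono hsub) (by
        intro p hp
        refine (hd p (hsub ?_) ?_).differentiableWithinAt
        · exact ⟨Ioo_subset_Icc_self hp.1, Ioo_subset_Icc_self hp.2⟩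
        · intro h; exact h0 (h ▸ hp.2))
    simpa using this
  by_cases h0 : (0 : ℝ) ∈ uIcc z.im w.im
  · have h1 := key z.im 0 (uIcc_subset_uIcc left_mem_uIcc h0) (by
      rintro ⟨h, h'⟩; rcases le_total z.im 0 with h2 | h2 <;> simp_all)
    have h2 := key 0 w.im (uIcc_subset_uIcc h0 right_mem_uIcc) (by
      rintro ⟨h, h'⟩; rcases le_total w.im 0 with h2 | h2 <;> simp_all)
    have vert : ∀ c ∈ uIcc z.re w.re, ∀ a ∈ uIcc z.im w.im, ∀ b ∈ uIcc z.im w.im,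
        IntervalIntegrable (fun y : ℝ => g (c + y * Complex.I)) volume a b := by
      intro c hcm a ha b hb
      refine ContinuousOn.intervalIntegrable (hc.comp (by fun_prop) ?_)
      intro y hy
      refine hzw ⟨?_, ?_⟩
      · simpa using hcm
      · simpa using uIcc_subset_uIcc ha hb hy
    rw [← intervalIntegral.integral_add_adjacent_intervals
        (vert w.re right_mem_uIcc z.im left_mem_uIcc 0 h0)
        (vert w.re right_mem_uIcc 0 h0 w.im right_mem_uIcc),
      ← intervalIntegral.integral_add_adjacent_intervals
        (vert z.re left_mem_uIcc z.im left_mem_uIcc 0 h0)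
        (vert z.re left_mem_uIcc 0 h0 w.im right_mem_uIcc)]
    simp only [smul_add]
    linear_combination h1 + h2
  · exact key _ _ subset_rfl fun h => h0 (Ioo_subset_Icc_self h)

/-- Applied below to discs centred on the edge, which leave the wedge only for real values of the
parameter. -/
theorem circleAverage_of_off_real {g : ℂ → ℂ} (hc : ContinuousOn g (Metric.closedBall 0 1))
    (hd : ∀ z ∈ Metric.ball (0 : ℂ) 1, z.im ≠ 0 → DifferentiableAt ℂ g z) :
    Real.circleAverage g 0 1 = g 0 := by
  have h1 := differentiableOn_ball_of_off_real (hc.mono Metric.ball_subset_closedBall) hd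
  refine DiffContOnCl.circleAverage (R := 1) (c := 0) ⟨by simpa using h1, ?_⟩
  rw [abs_one, closure_ball _ one_ne_zero]
  exact hc

/-- A function that is continuous on a closed half disc, holomorphic inside, and zero on the
diameter vanishes. -/
theorem eq_zero_of_eq_zero_on_real {g : ℂ → ℂ} {r : ℝ}
    (hc : ContinuousOn g (Metric.ball 0 r ∩ {z | 0 ≤ z.im}))
    (hd : ∀ z ∈ Metric.ball (0 : ℂ) r, 0 < z.im → DifferentiableAt ℂ g z)
    (h0 : ∀ z ∈ Metric.ball (0 : ℂ) r, z.im = 0 → g z = 0) :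
    ∀ z ∈ Metric.ball (0 : ℂ) r, 0 < z.im → g z = 0 := by
  classical
  intro z hz hzi
  -- The extension by zero to the lower half disc is continuous, hence holomorphic by Painlevé, and
  -- it vanishes on an open set.
  let G : ℂ → ℂ := fun z => if 0 ≤ z.im then g z else 0
  have hGc : ContinuousOn G (Metric.ball 0 r) := by
    refine ContinuousOn.if ?_ ?_ continuousOn_const
    · rintro a ⟨ha, ha'⟩
      refine h0 a ha ?_
      have : frontier {a : ℂ | 0 ≤ a.im} = {a | a.im = 0} := Complex.frontier_setOfPred_le_im 0
      rw [this] at ha'; exact ha'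
    · refine hc.mono ?_
      rw [IsClosed.closure_eq (isClosed_le continuous_const Complex.continuous_im)]
  have hGd := differentiableOn_ball_of_off_real hGc (by
    intro p hp hpi
    rcases lt_or_gt_of_ne hpi with h | h
    · refine (differentiableAt_const (0 : ℂ)).congr_of_eventuallyEq ?_
      filter_upwards [(isOpen_lt Complex.continuous_im continuous_const).mem_nhds h] with q hq
      exact if_neg (not_le.2 hq)
    · refine (hd p hp h).congr_of_eventuallyEq ?_
      filter_upwards [(isOpen_lt continuous_const Complex.continuous_im).mem_nhds h] with q hq
      exact if_pos (le_of_lt hq))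
  have hr : 0 < r := Metric.pos_of_mem_ball hz
  let p : ℂ := -(r / 2 : ℝ) * Complex.I
  have hp : p ∈ Metric.ball (0 : ℂ) r := by
    simp [p, abs_of_pos hr, hr]
  have hev : G =ᶠ[𝓝 p] 0 := by
    have : p.im < 0 := by simp [p, hr]
    filter_upwards [(isOpen_lt Complex.continuous_im continuous_const).mem_nhds this] with q hq
    exact if_neg (not_le.2 hq)
  have := (hGd.analyticOnNhd Metric.isOpen_ball).eqOn_zero_of_preconnected_of_eventuallyEq_zero
    (convex_ball 0 r).isPreconnected hp hev hz
  simpa [G, hzi.le] using this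

end OneVariable

/-! ### Holomorphic dependence of integrals on parameters -/

section ParametricIntegral

variable {α : Type*} [MeasurableSpace α] {μ : Measure α} {H : Type*} [NormedAddCommGroup H]
  [NormedSpace ℂ H]

/-- The derivative is a pointwise limit of difference quotients with steps `1 / (k + 1)`, each of
which is measurable. -/
theorem aestronglyMeasurable_fderiv_apply {F : H → α → ℂ} {U : Set H} (hU : IsOpen U)
    (hmeas : ∀ z ∈ U, AEStronglyMeasurable (F z) μ)
    (hd : ∀ᵐ a ∂μ, DifferentiableOn ℂ (fun z => F z a) U) {z : H} (hz : z ∈ U) (v : H) :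
    AEStronglyMeasurable (fun a => fderiv ℂ (fun z => F z a) z v) μ := by
  have hc : Tendsto (fun k : ℕ => (((k : ℝ) + 1 : ℝ) : ℂ)⁻¹) atTop (𝓝 0) := by
    have := (Complex.continuous_ofReal.tendsto 0).comp
      (tendsto_one_div_add_atTop_nhds_zero_nat (𝕜 := ℝ))
    simpa [Function.comp_def] using this
  have hev : ∀ᶠ k : ℕ in atTop, z + (((k : ℝ) + 1 : ℝ) : ℂ)⁻¹ • v ∈ U := by
    have : Tendsto (fun k : ℕ => z + (((k : ℝ) + 1 : ℝ) : ℂ)⁻¹ • v) atTop (𝓝 (z + (0 : ℂ) • v)) :=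
      tendsto_const_nhds.add (hc.smul_const v)
    rw [zero_smul, add_zero] at this
    exact this.eventually (hU.mem_nhds hz)
  obtain ⟨k₀, hk₀⟩ := eventually_atTop.1 hev
  refine aestronglyMeasurable_of_tendsto_ae atTop
    (f := fun (k : ℕ) a => (((k + k₀ : ℕ) : ℝ) + 1 : ℝ) •
      (F (z + ((((k + k₀ : ℕ) : ℝ) + 1 : ℝ) : ℂ)⁻¹ • v) a - F z a)) ?_ ?_
  · intro k
    have h := (hmeas _ (hk₀ (k + k₀) (Nat.le_add_left _ _))).sub (hmeas z hz)
    exact h.const_smul (((k + k₀ : ℕ) : ℝ) + 1)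
  · filter_upwards [hd] with a ha
    have h1 : HasFDerivAt (fun z => F z a) (fderiv ℂ (fun z => F z a) z) z :=
      (ha.differentiableAt (hU.mem_nhds hz)).hasFDerivAt
    have h2 := h1.lim v (l := (atTop : Filter ℕ)) (c := fun k : ℕ => ((((k : ℝ) + 1 : ℝ)) : ℂ)) (by
        have h : Tendsto (fun k : ℕ => (k : ℝ) + 1) atTop atTop :=
          tendsto_atTop_add_const_right _ _ tendsto_natCast_atTop_atTop
        refine (tendsto_norm_atTop_atTop.comp h).congr fun k => ?_
        simp only [Function.comp_apply, Complex.norm_real])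
    refine ((tendsto_add_atTop_iff_nat k₀).2 h2).congr fun k => ?_
    rw [Complex.real_smul, smul_eq_mul]

/-- Cauchy's estimate on a ball of half the radius converts the bound on `F` into a bound on its
derivative, so dominating `F` is enough. -/
theorem differentiableOn_integral_of_norm_le [FiniteDimensional ℂ H] {F : H → α → ℂ} {U : Set H}
    (hU : IsOpen U) (hmeas : ∀ z ∈ U, AEStronglyMeasurable (F z) μ)
    (hd : ∀ᵐ a ∂μ, DifferentiableOn ℂ (fun z => F z a) U) {b : α → ℝ} (hb : Integrable b μ)
    (hF : ∀ᵐ a ∂μ, ∀ z ∈ U, ‖F z a‖ ≤ b a) :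
    DifferentiableOn ℂ (fun z => ∫ a, F z a ∂μ) U := by
  intro z₀ hz₀
  obtain ⟨r, hr, hrU⟩ := Metric.isOpen_iff.1 hU z₀ hz₀
  have hr2 : 0 < r / 2 := by positivity
  have hsub : ∀ z ∈ Metric.ball z₀ (r / 2), Metric.ball z (r / 2) ⊆ U := by
    intro z hz
    refine (Metric.ball_subset_ball' ?_).trans hrU
    rw [Metric.mem_ball] at hz; linarith
  have hmemU : ∀ z ∈ Metric.ball z₀ (r / 2), z ∈ U := fun z hz =>
    hsub z hz (Metric.mem_ball_self hr2)
  refine (hasFDerivAt_integral_of_dominated_of_fderiv_le (𝕜 := ℂ) (s := Metric.ball z₀ (r / 2))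
    (F' := fun z a => fderiv ℂ (fun z => F z a) z) (bound := fun a => 2 * b a / (r / 2))
    (Metric.ball_mem_nhds _ hr2) ?_ ?_ ?_ ?_ ?_ ?_).differentiableAt.differentiableWithinAt
  · filter_upwards [hU.mem_nhds hz₀] with z hz using hmeas z hz
  · refine hb.mono' (hmeas z₀ hz₀) ?_
    filter_upwards [hF] with a ha using ha z₀ hz₀
  · let B := Module.finBasis ℂ H
    have : (fun a => fderiv ℂ (fun z => F z a) z₀) = fun a => ∑ i,
        (fderiv ℂ (fun z => F z a) z₀ (B i)) • (LinearMap.toContinuousLinearMap (B.coord i)) := by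
      ext a v
      conv_lhs => rw [← B.sum_repr v, map_sum]
      simp [mul_comm]
    rw [this]
    refine Finset.aestronglyMeasurable_fun_sum _ fun i _ => ?_
    exact (aestronglyMeasurable_fderiv_apply hU hmeas hd hz₀ (B i)).smul_const _
  · filter_upwards [hF, hd] with a ha hda z hz
    refine Complex.norm_fderiv_le_div_of_mapsTo_ball (hda.mono (hsub z hz)) ?_ hr2
    intro w hw
    rw [Metric.mem_closedBall, dist_eq_norm]
    linarith [norm_sub_le (F w a) (F z a), ha w (hsub z hz hw), ha z (hmemU z hz)]
  · exact (hb.const_mul 2).div_const _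
  · filter_upwards [hd] with a ha z hz
    exact (ha.differentiableAt (hU.mem_nhds (hmemU z hz))).hasFDerivAt

end ParametricIntegral

/-! ### Uniform boundedness of the functions `f(· + iY)` -/

/-- The functions `f(· + iY)`, paired with smooth functions that are supported in the ball of radius
`R` around the origin, converge as `Y → 0` in `C`. -/
def HasLocalLimit {n : ℕ} (C : Set (Fin n → ℝ)) (R : ℝ) (f : (Fin n → ℂ) → ℂ) : Prop :=
  ∀ R' < R, ∀ φ : (Fin n → ℝ) → ℝ, ContDiff ℝ (⊤ : ℕ∞) φ →
    Function.support φ ⊆ Metric.closedBall 0 R' →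
    ∃ c : ℂ, Tendsto (fun Y => ∫ x, (φ x : ℂ) * f (toComplex x Y)) (𝓝[C] 0) (𝓝 c)

section UniformBoundedness

variable {n : ℕ}

theorem integrable_mul_of_support {φ : (Fin n → ℝ) → ℝ} (hφ : Continuous φ) {R : ℝ}
    (hs : Function.support φ ⊆ Metric.closedBall 0 R) {g : (Fin n → ℝ) → ℂ}
    (hg : ContinuousOn g (Metric.closedBall 0 R)) :
    Integrable (fun x => (φ x : ℂ) * g x) := by
  have h1 : IntegrableOn (fun x => (φ x : ℂ) * g x) (Metric.closedBall 0 R) :=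
    ContinuousOn.integrableOn_compact (isCompact_closedBall _ _) (by fun_prop)
  refine (integrableOn_iff_integrable_of_support_subset ?_).1 h1
  intro x hx
  refine hs ?_
  intro h; simp [h] at hx

theorem norm_le_one_of_iteratedFDeriv {φ : (Fin n → ℝ) → ℝ} {k : ℕ}
    (h : ∀ i ≤ k, ∀ x, ‖iteratedFDeriv ℝ i φ x‖ ≤ 1) (x : Fin n → ℝ) : ‖φ x‖ ≤ 1 := by
  simpa using h 0 (Nat.zero_le _) x

/-- Sequences of increasingly smooth bounded functions can be summed with geometric weights. -/
theorem contDiff_tsum_geometric {φ : ℕ → (Fin n → ℝ) → ℝ}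
    (hφ : ∀ k, ContDiff ℝ (⊤ : ℕ∞) (φ k))
    (hb : ∀ k, ∀ i ≤ k, ∀ x, ‖iteratedFDeriv ℝ i (φ k) x‖ ≤ 1) (a : BoundedContinuousFunction ℕ ℝ) :
    ContDiff ℝ (⊤ : ℕ∞) (fun x => ∑' k, (a k * (1 / 2) ^ k) * φ k x) := by
  refine contDiff_tsum_of_eventually (v := fun _ k => ‖a‖ * (1 / 2) ^ k) ?_ ?_ ?_
  · exact fun k => contDiff_const.mul (hφ k)
  · exact fun _ _ => summable_geometric_two.mul_left _
  · intro i _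
    rw [Nat.cofinite_eq_atTop]
    filter_upwards [eventually_ge_atTop i] with k hk x
    have : (fun x => (a k * (1 / 2) ^ k) * φ k x) = (a k * (1 / 2) ^ k) • φ k := rfl
    rw [this, iteratedFDeriv_const_smul_apply
      (((hφ k).of_le (by exact_mod_cast le_top)).contDiffAt), norm_smul, norm_mul]
    have h1 := hb k i hk x
    have h2 := a.norm_coe_le_norm k
    have h3 : ‖((1 : ℝ) / 2) ^ k‖ = (1 / 2) ^ k := by simp
    rw [h3]
    calc _ ≤ ‖a‖ * (1 / 2) ^ k * 1 := by gcongr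
      _ = _ := mul_one _

theorem summable_geometric_mul {φ : ℕ → (Fin n → ℝ) → ℝ} (hb : ∀ k x, ‖φ k x‖ ≤ 1)
    (a : BoundedContinuousFunction ℕ ℝ) (x : Fin n → ℝ) :
    Summable (fun k => (a k * (1 / 2) ^ k) * φ k x) ∧
      ‖∑' k, (a k * (1 / 2) ^ k) * φ k x‖ ≤ ‖a‖ * 2 := by
  have h : ∀ k, ‖(a k * (1 / 2) ^ k) * φ k x‖ ≤ ‖a‖ * (1 / 2) ^ k := by
    intro k
    rw [norm_mul, norm_mul]
    have h3 : ‖((1 : ℝ) / 2) ^ k‖ = (1 / 2) ^ k := by simp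
    rw [h3]
    calc _ ≤ ‖a‖ * (1 / 2) ^ k * 1 := by gcongr; exacts [a.norm_coe_le_norm k, hb k x]
      _ = _ := mul_one _
  exact ⟨Summable.of_norm_bounded (summable_geometric_two.mul_left _) h,
    tsum_of_norm_bounded (hasSum_geometric_two.mul_left _) h⟩

/-- A pairing with a weighted series of functions is a continuous linear form in the weights. -/
theorem exists_pairing_clm {φ : ℕ → (Fin n → ℝ) → ℝ} (hφ : ∀ k, ContDiff ℝ (⊤ : ℕ∞) (φ k))
    (hb : ∀ k, ∀ i ≤ k, ∀ x, ‖iteratedFDeriv ℝ i (φ k) x‖ ≤ 1) {R : ℝ}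
    (hs : ∀ k, Function.support (φ k) ⊆ Metric.closedBall 0 R) {g : (Fin n → ℝ) → ℂ}
    (hg : ContinuousOn g (Metric.closedBall 0 R)) :
    ∃ L : BoundedContinuousFunction ℕ ℝ →L[ℝ] ℂ,
      ∀ a, L a = ∫ x, ((∑' k, (a k * (1 / 2) ^ k) * φ k x : ℝ) : ℂ) * g x := by
  have hb1 : ∀ k x, ‖φ k x‖ ≤ 1 := fun k x => norm_le_one_of_iteratedFDeriv (hb k) x
  have hsupp : ∀ a : BoundedContinuousFunction ℕ ℝ,
      Function.support (fun x => ∑' k, (a k * (1 / 2) ^ k) * φ k x) ⊆ Metric.closedBall 0 R := by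
    intro a x hx
    by_contra hxR
    have h0 : ∀ k, φ k x = 0 := fun k => by
      by_contra h; exact hxR (hs k h)
    exact hx (by simp [h0])
  have hint := fun a => integrable_mul_of_support (contDiff_tsum_geometric hφ hb a).continuous
    (hsupp a) hg
  let L : BoundedContinuousFunction ℕ ℝ →ₗ[ℝ] ℂ :=
    { toFun := fun a => ∫ x, ((∑' k, (a k * (1 / 2) ^ k) * φ k x : ℝ) : ℂ) * g x
      map_add' := by
        intro a b
        rw [← integral_add (hint a) (hint b)]
        congr 1; ext x
        rw [← add_mul, ← Complex.ofReal_add,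
          ← (summable_geometric_mul hb1 a x).1.tsum_add (summable_geometric_mul hb1 b x).1]
        simp [add_mul]
      map_smul' := by
        intro c a
        rw [RingHom.id_apply, ← integral_smul]
        congr 1; ext x
        rw [Complex.real_smul, ← mul_assoc, ← Complex.ofReal_mul, ← tsum_mul_left]
        simp [mul_assoc] }
  refine ⟨L.mkContinuous (2 * ∫ x in Metric.closedBall 0 R, ‖g x‖) fun a => ?_, fun a => rfl⟩
  change ‖∫ x, ((∑' k, (a k * (1 / 2) ^ k) * φ k x : ℝ) : ℂ) * g x‖ ≤ _
  rw [← setIntegral_eq_integral_of_forall_compl_eq_zero (s := Metric.closedBall 0 R) (by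
    intro x hx
    have : ∑' k, (a k * (1 / 2) ^ k) * φ k x = 0 := by
      by_contra h; exact hx (hsupp a h)
    rw [this]; simp)]
  have : 2 * (∫ x in Metric.closedBall 0 R, ‖g x‖) * ‖a‖ =
      ∫ x in Metric.closedBall 0 R, (‖a‖ * 2) * ‖g x‖ := by
    rw [integral_const_mul]; ring
  rw [this]
  refine norm_integral_le_of_norm_le ?_ (Eventually.of_forall fun x => ?_)
  · exact (hg.norm.integrableOn_compact (isCompact_closedBall _ _)).const_mul _
  · rw [norm_mul, Complex.norm_real]
    gcongr
    exact (summable_geometric_mul hb1 a x).2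

/-- The uniform boundedness principle for the functions `f(· + iY)`, as distributions. -/
theorem exists_uniform_bound_unit {C : Set (Fin n → ℝ)} {R R' : ℝ} (hR' : R' < R)
    {f : (Fin n → ℂ) → ℂ} (hf : ContinuousOn f (tube C R)) (hlim : HasLocalLimit C R f)
    (hR : 0 < R) :
    ∃ N : ℕ, ∃ δ > 0, δ ≤ R ∧ ∃ A : ℝ, ∀ Y ∈ C, ‖Y‖ < δ → ∀ φ : (Fin n → ℝ) → ℝ,
      ContDiff ℝ (⊤ : ℕ∞) φ → Function.support φ ⊆ Metric.closedBall 0 R' →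
      (∀ i ≤ N, ∀ x, ‖iteratedFDeriv ℝ i φ x‖ ≤ 1) →
      ‖∫ x, (φ x : ℂ) * f (toComplex x Y)‖ ≤ A := by
  by_contra! hcon
  have hδ : ∀ k : ℕ, 0 < min R (1 / ((k : ℝ) + 1)) := fun k => lt_min hR (by positivity)
  -- If no order `N` works, there are `Y k → 0` and `φ k`, bounded by `1` up to order `k`, whose
  -- pairings exceed `k * 2 ^ k`. The series `∑ a k * 2 ^ (-k) * φ k` is a test function for every
  -- bounded sequence `a`, so Banach–Steinhaus can be applied on the Banach space of bounded
  -- sequences instead of a Fréchet space of test functions.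
  choose Y hYC hY φ hφ hs hb hbig using fun k : ℕ =>
    hcon k (min R (1 / ((k : ℝ) + 1))) (hδ k) (min_le_left _ _) (k * 2 ^ k)
  have hg : ∀ k, ContinuousOn (fun x => f (toComplex x (Y k))) (Metric.closedBall 0 R') := by
    intro k
    refine hf.comp (by fun_prop) ?_
    intro x hx
    rw [mem_closedBall_zero_iff] at hx
    exact ⟨by simpa using hx.trans_lt hR', by simpa using (hY k).trans_le (min_le_left _ _),
      by simpa using hYC k⟩
  choose L hL using fun k => exists_pairing_clm hφ hb hs (hg k)
  have hY0 : Tendsto Y atTop (𝓝[C] 0) := by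
    refine tendsto_nhdsWithin_iff.2 ⟨?_, Eventually.of_forall hYC⟩
    refine squeeze_zero_norm (fun k => ((hY k).trans_le (min_le_right _ _)).le)
      tendsto_one_div_add_atTop_nhds_zero_nat
  have hsupp : ∀ a : BoundedContinuousFunction ℕ ℝ,
      Function.support (fun x => ∑' k, (a k * (1 / 2) ^ k) * φ k x) ⊆ Metric.closedBall 0 R' := by
    intro a x hx
    by_contra hxR
    have h0 : ∀ k, φ k x = 0 := fun k => by
      by_contra h; exact hxR (hs k h)
    exact hx (by simp [h0])
  obtain ⟨M, hM⟩ := banach_steinhaus (g := L) (by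
    intro a
    obtain ⟨c, hc⟩ := hlim R' hR' _ (contDiff_tsum_geometric hφ hb a) (hsupp a)
    obtain ⟨B, hB⟩ := (hc.comp hY0).norm.bddAbove_range
    refine ⟨B, fun k => ?_⟩
    rw [hL]
    exact hB ⟨k, rfl⟩)
  obtain ⟨k, hk⟩ := exists_nat_gt M
  -- The `k`-th unit sequence isolates `φ k`. Its pairing has modulus more than `k > M` after the
  -- weight `2 ^ (-k)`, a contradiction.
  let a : BoundedContinuousFunction ℕ ℝ :=
    BoundedContinuousFunction.ofNormedAddCommGroup (fun j => if j = k then 1 else 0)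
      continuous_of_discreteTopology 1 (by intro j; split_ifs <;> simp)
  have ha : ‖a‖ ≤ 1 := BoundedContinuousFunction.norm_ofNormedAddCommGroup_le _ zero_le_one _
  have h1 : ‖L k a‖ ≤ M := by
    calc ‖L k a‖ ≤ ‖L k‖ * ‖a‖ := (L k).le_opNorm a
      _ ≤ M * 1 := mul_le_mul (hM k) ha (norm_nonneg _) ((norm_nonneg _).trans (hM k))
      _ = M := mul_one M
  have h2 : ∀ x, ∑' j, (a j * (1 / 2) ^ j) * φ j x = (1 / 2) ^ k * φ k x := by
    intro x
    rw [tsum_eq_single k]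
    · simp [a]
    · intro j hj; simp [a, hj]
  rw [hL] at h1
  simp only [h2] at h1
  simp only [Complex.ofReal_mul, mul_assoc] at h1
  rw [integral_const_mul, norm_mul, Complex.norm_real] at h1
  have h3 : ‖((1 : ℝ) / 2) ^ k‖ = (2 ^ k)⁻¹ := by simp
  rw [h3, inv_mul_le_iff₀ (by positivity)] at h1
  have h4 := hbig k
  have : (2 : ℝ) ^ k * M ≤ k * 2 ^ k := by rw [mul_comm]; gcongr
  linarith

theorem exists_uniform_bound {C : Set (Fin n → ℝ)} {R R' : ℝ} (hR' : R' < R)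
    {f : (Fin n → ℂ) → ℂ} (hf : ContinuousOn f (tube C R)) (hlim : HasLocalLimit C R f)
    (hR : 0 < R) :
    ∃ N : ℕ, ∃ δ > 0, δ ≤ R ∧ ∃ A ≥ 0, ∀ Y ∈ C, ‖Y‖ < δ → ∀ φ : (Fin n → ℝ) → ℝ,
      ContDiff ℝ (⊤ : ℕ∞) φ → Function.support φ ⊆ Metric.closedBall 0 R' →
      ∀ B ≥ 0, (∀ i ≤ N, ∀ x, ‖iteratedFDeriv ℝ i φ x‖ ≤ B) →
      ‖∫ x, (φ x : ℂ) * f (toComplex x Y)‖ ≤ A * B := by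
  obtain ⟨N, δ, hδ, hδR, A, hA⟩ := exists_uniform_bound_unit hR' hf hlim hR
  refine ⟨N, δ, hδ, hδR, |A|, abs_nonneg _, ?_⟩
  intro Y hY hYδ φ hφ hs B hB hb
  have key : ∀ B' > 0, (∀ i ≤ N, ∀ x, ‖iteratedFDeriv ℝ i φ x‖ ≤ B') →
      ‖∫ x, (φ x : ℂ) * f (toComplex x Y)‖ ≤ |A| * B' := by
    intro B' hB' hb'
    have h := hA Y hY hYδ (B'⁻¹ • φ) (contDiff_const.smul hφ)
      ((Function.support_const_smul_subset _ _).trans hs) (by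
        intro i hi x
        rw [iteratedFDeriv_const_smul_apply
          ((hφ.of_le (by exact_mod_cast le_top)).contDiffAt), norm_smul, norm_inv,
          Real.norm_of_nonneg hB'.le, inv_mul_le_iff₀ hB', mul_one]
        exact hb' i hi x)
    simp only [Pi.smul_apply, smul_eq_mul, Complex.ofReal_mul, mul_assoc] at h
    rw [integral_const_mul, norm_mul, Complex.norm_real, norm_inv, Real.norm_of_nonneg hB'.le,
      inv_mul_le_iff₀ hB', mul_comm] at h
    exact h.trans (by gcongr; exact le_abs_self A)
  -- Rescaling by `B'⁻¹` needs a positive bound; `B = 0` is reached by approximation.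
  refine le_of_forall_pos_le_add fun ε hε => ?_
  have hpos : 0 < ε / (|A| + 1) := by positivity
  have := key (B + ε / (|A| + 1)) (by positivity) fun i hi x => (hb i hi x).trans (by linarith)
  have h5 : |A| * (ε / (|A| + 1)) ≤ ε := by
    rw [← mul_div_assoc, div_le_iff₀ (by positivity)]; nlinarith [abs_nonneg A]
  linarith

end UniformBoundedness

/-! ### Mean value property for circle-invariant weights -/

section MeanValue

variable {n : ℕ}

theorem measurePreserving_smul_of_norm_eq_one {c : ℂ} (hc : ‖c‖ = 1) :
    MeasurePreserving (fun ζ : Fin n → ℂ => c • ζ) := by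
  let a : Circle := ⟨c, mem_sphere_zero_iff_norm.2 hc⟩
  exact volume_preserving_pi (ι := Fin n) (f := fun _ => rotation a)
    fun _ => LinearIsometryEquiv.measurePreserving _

theorem measurePreserving_toComplex :
    MeasurePreserving (fun p : (Fin n → ℝ) × (Fin n → ℝ) => toComplex p.1 p.2) := by
  have h1 := (volume_measurePreserving_arrowProdEquivProdArrow ℝ ℝ (Fin n)).symm
  have h2 := volume_preserving_pi (ι := Fin n)
    (fun _ => Complex.volume_preserving_equiv_real_prod.symm)
  convert h2.comp h1 using 1
  ext p j
  simp only [toComplex, Function.comp_apply]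
  apply Complex.ext
  · simp; rfl
  · simp; rfl

theorem measurableEmbedding_toComplex :
    MeasurableEmbedding (fun p : (Fin n → ℝ) × (Fin n → ℝ) => toComplex p.1 p.2) := by
  refine Continuous.measurableEmbedding continuous_toComplex ?_
  intro p q h
  refine Prod.ext ?_ ?_
  · simpa using congrArg reVec h
  · simpa using congrArg imVec h

theorem circleAverage_comp_line {f : (Fin n → ℂ) → ℂ} {z ζ : Fin n → ℂ} {ρ : ℝ}
    (hf : DifferentiableOn ℂ f (Metric.ball z ρ)) (hζ : ‖ζ‖ < ρ) :
    Real.circleAverage (fun c => f (z + c • ζ)) 0 1 = f z := by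
  have h : DifferentiableOn ℂ (fun c : ℂ => f (z + c • ζ)) (closure (Metric.ball 0 |1|)) := by
    refine hf.comp (by fun_prop) ?_
    intro c hc
    rw [abs_one, closure_ball _ one_ne_zero, mem_closedBall_zero_iff] at hc
    rw [mem_ball_iff_norm, add_sub_cancel_left, norm_smul]
    exact (mul_le_of_le_one_left (norm_nonneg _) hc).trans_lt hζ
  simpa using DiffContOnCl.circleAverage (R := 1) (c := 0) h.diffContOnCl

/-- The mean value property of holomorphic functions for weights that are invariant under the
diagonal action of the circle. -/
theorem integral_mul_eq_of_rotation_invariant {f : (Fin n → ℂ) → ℂ} {z : Fin n → ℂ} {ρ ρ' : ℝ}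
    (hf : DifferentiableOn ℂ f (Metric.ball z ρ)) (hρ : ρ' < ρ) {ψ : (Fin n → ℂ) → ℝ}
    (hψ : Continuous ψ) (hs : Function.support ψ ⊆ Metric.closedBall 0 ρ')
    (hinv : ∀ c : ℂ, ‖c‖ = 1 → ∀ ζ, ψ (c • ζ) = ψ ζ) :
    ∫ ζ, (ψ ζ : ℂ) * f (z + ζ) = ((∫ ζ, ψ ζ : ℝ) : ℂ) * f z := by
  -- The integral over `θ` and `ζ` is evaluated in both orders: integrating over `ζ` first, rotation
  -- invariance removes `θ`; integrating over `θ` first, the one-variable mean value property gives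
  -- `f z`.
  have hrot : ∀ θ : ℝ, ∫ ζ, (ψ ζ : ℂ) * f (z + circleMap 0 1 θ • ζ) =
      ∫ ζ, (ψ ζ : ℂ) * f (z + ζ) := by
    intro θ
    have hc : ‖circleMap 0 1 θ‖ = 1 := by simp
    have hc0 : circleMap 0 1 θ ≠ 0 := by rw [← norm_pos_iff, hc]; exact one_pos
    rw [← (measurePreserving_smul_of_norm_eq_one (n := n) hc).integral_comp
      (Homeomorph.smulOfNeZero _ hc0).measurableEmbedding fun ζ => (ψ ζ : ℂ) * f (z + ζ)]
    simp only [hinv _ hc]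
  have hzero : ∀ θ : ℝ, ∀ ζ ∉ Metric.closedBall (0 : Fin n → ℂ) ρ',
      (ψ ζ : ℂ) * f (z + circleMap 0 1 θ • ζ) = 0 := by
    intro θ ζ hζ
    have : ψ ζ = 0 := by by_contra h; exact hζ (hs h)
    simp [this]
  have hint : Integrable (Function.uncurry fun (θ : ℝ) (ζ : Fin n → ℂ) =>
      (ψ ζ : ℂ) * f (z + circleMap 0 1 θ • ζ))
      ((volume.restrict (uIoc 0 (2 * Real.pi))).prod
        (volume.restrict (Metric.closedBall 0 ρ'))) := by
    rw [Measure.prod_restrict, ← Measure.volume_eq_prod]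
    refine IntegrableOn.mono_set (t := uIcc 0 (2 * Real.pi) ×ˢ Metric.closedBall 0 ρ') ?_
      (prod_mono_left uIoc_subset_uIcc)
    refine ContinuousOn.integrableOn_compact (isCompact_uIcc.prod (isCompact_closedBall _ _)) ?_
    refine ContinuousOn.mul (by fun_prop) (hf.continuousOn.comp ?_ ?_)
    · have : Continuous fun p : ℝ × (Fin n → ℂ) => circleMap 0 1 p.1 :=
        (continuous_circleMap 0 1).comp continuous_fst
      fun_prop
    · rintro ⟨θ, ζ⟩ ⟨_, hζ⟩
      rw [mem_closedBall_zero_iff] at hζ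
      rw [mem_ball_iff_norm, add_sub_cancel_left, norm_smul]
      simpa using hζ.trans_lt hρ
  have h1 : (∫ θ in (0 : ℝ)..2 * Real.pi, ∫ ζ in Metric.closedBall 0 ρ',
      (ψ ζ : ℂ) * f (z + circleMap 0 1 θ • ζ)) =
      (2 * Real.pi) • ∫ ζ, (ψ ζ : ℂ) * f (z + ζ) := by
    have : ∀ θ : ℝ, ∫ ζ in Metric.closedBall 0 ρ', (ψ ζ : ℂ) * f (z + circleMap 0 1 θ • ζ) =
        ∫ ζ, (ψ ζ : ℂ) * f (z + ζ) := fun θ => by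
      rw [setIntegral_eq_integral_of_forall_compl_eq_zero (hzero θ), hrot]
    simp only [this, intervalIntegral.integral_const, sub_zero]
  have h2 : (∫ ζ in Metric.closedBall 0 ρ', ∫ θ in (0 : ℝ)..2 * Real.pi,
      (ψ ζ : ℂ) * f (z + circleMap 0 1 θ • ζ)) =
      ∫ ζ in Metric.closedBall 0 ρ', (ψ ζ : ℂ) * ((2 * Real.pi) • f z) := by
    refine setIntegral_congr_fun Metric.isClosed_closedBall.measurableSet fun ζ hζ => ?_
    rw [mem_closedBall_zero_iff] at hζ
    have := circleAverage_comp_line hf (hζ.trans_lt hρ)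
    rw [Real.circleAverage_def, inv_smul_eq_iff₀ (by positivity)] at this
    simp only [intervalIntegral.integral_const_mul, this]
  have h3 : (∫ ζ in Metric.closedBall 0 ρ', (ψ ζ : ℂ) * ((2 * Real.pi) • f z)) =
      (2 * Real.pi) • (((∫ ζ, ψ ζ : ℝ) : ℂ) * f z) := by
    rw [setIntegral_eq_integral_of_forall_compl_eq_zero, integral_mul_const, integral_complex_ofReal,
      mul_smul_comm]
    intro ζ hζ
    have : ψ ζ = 0 := by by_contra h; exact hζ (hs h)
    simp [this]
  rw [intervalIntegral_integral_swap hint, h2, h3] at h1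
  exact (smul_right_injective ℂ (by positivity : (2 * Real.pi) ≠ 0) h1).symm

end MeanValue

/-! ### Polynomial growth at the edge -/

section Growth

variable {n : ℕ}

/-- A bump function on `ℂⁿ`, in real coordinates, that is invariant under the unitary group. -/
noncomputable def radialBump (p : (Fin n → ℝ) × (Fin n → ℝ)) : ℝ :=
  Real.smoothTransition (1 - 4 * ∑ j, (p.1 j ^ 2 + p.2 j ^ 2))

theorem contDiff_radialBump : ContDiff ℝ (⊤ : ℕ∞) (radialBump (n := n)) := by
  unfold radialBump
  refine Real.smoothTransition.contDiff.comp ?_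
  fun_prop

theorem norm_le_of_radialBump_ne_zero {p : (Fin n → ℝ) × (Fin n → ℝ)} (hp : radialBump p ≠ 0) :
    ‖toComplex p.1 p.2‖ ≤ 1 / 2 := by
  have h : 0 < 1 - 4 * ∑ j, (p.1 j ^ 2 + p.2 j ^ 2) := by
    by_contra h
    exact hp (Real.smoothTransition.zero_of_nonpos (not_lt.1 h))
  refine (pi_norm_le_iff_of_nonneg (by norm_num)).2 fun j => ?_
  have h1 : p.1 j ^ 2 + p.2 j ^ 2 ≤ ∑ j, (p.1 j ^ 2 + p.2 j ^ 2) :=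
    Finset.single_le_sum (f := fun j => p.1 j ^ 2 + p.2 j ^ 2) (fun j _ => by positivity)
      (Finset.mem_univ j)
  have h2 : ‖toComplex p.1 p.2 j‖ ^ 2 = p.1 j ^ 2 + p.2 j ^ 2 := by
    rw [← Complex.normSq_eq_norm_sq]
    simp [toComplex, Complex.normSq_apply]; ring
  nlinarith [norm_nonneg (toComplex p.1 p.2 j)]

theorem radialBump_smul {c : ℂ} (hc : ‖c‖ = 1) (ζ : Fin n → ℂ) (a : ℝ) :
    radialBump (a • reVec (c • ζ), a • imVec (c • ζ)) =
      radialBump (a • reVec ζ, a • imVec ζ) := by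
  have h : c.re * c.re + c.im * c.im = 1 := by
    rw [← Complex.normSq_apply, Complex.normSq_eq_norm_sq, hc, one_pow]
  unfold radialBump
  congr 3
  refine Finset.sum_congr rfl fun j _ => ?_
  simp only [reVec, imVec, Pi.smul_apply, smul_eq_mul, Complex.mul_re, Complex.mul_im]
  linear_combination a ^ 2 * ((ζ j).re ^ 2 + (ζ j).im ^ 2) * h

theorem hasCompactSupport_radialBump : HasCompactSupport (radialBump (n := n)) := by
  refine HasCompactSupport.intro (isCompact_closedBall 0 (1 / 2)) fun p hp => ?_
  by_contra h
  have := norm_le_of_radialBump_ne_zero h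
  refine hp (mem_closedBall_zero_iff.2 ?_)
  rw [Prod.norm_def]
  refine max_le ?_ ?_
  · simpa using (norm_reVec_le _).trans this
  · simpa using (norm_imVec_le _).trans this

/-- Each derivative costs a factor `r⁻¹`, and `r ≤ 1` lets order `N` dominate the lower ones. The
bound is uniform in the frozen imaginary variable `η`. -/
theorem exists_iteratedFDeriv_radialBump_le (N : ℕ) :
    ∃ Q ≥ 0, ∀ i ≤ N, ∀ r : ℝ, 0 < r → r ≤ 1 → ∀ x η t : Fin n → ℝ,
      ‖iteratedFDeriv ℝ i (fun t => radialBump (r⁻¹ • (t - x), η)) t‖ ≤ Q / r ^ N := by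
  have hb : ∀ i : ℕ, ∃ Q, ∀ p, ‖iteratedFDeriv ℝ i (radialBump (n := n)) p‖ ≤ Q := fun i =>
    Continuous.bounded_above_of_compact_support
      (contDiff_radialBump.continuous_iteratedFDeriv (by exact_mod_cast le_top))
      (hasCompactSupport_radialBump.iteratedFDeriv i)
  choose Q hQ using hb
  refine ⟨∑ i ∈ Finset.range (N + 1), |Q i|, Finset.sum_nonneg fun i _ => abs_nonneg _, ?_⟩
  intro i hi r hr hr1 x η t
  let L : (Fin n → ℝ) →L[ℝ] (Fin n → ℝ) × (Fin n → ℝ) :=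
    r⁻¹ • ContinuousLinearMap.inl ℝ (Fin n → ℝ) (Fin n → ℝ)
  have hL : ‖L‖ ≤ r⁻¹ := by
    refine ContinuousLinearMap.opNorm_le_bound _ (by positivity) fun v => ?_
    simp [L, norm_smul, Prod.norm_def, abs_of_pos hr]
    positivity
  have heq : (fun t => radialBump (r⁻¹ • (t - x), η)) =
      (fun p => radialBump (p + (-(r⁻¹ • x), η))) ∘ L := by
    ext t
    simp [L, sub_eq_add_neg]
  have hsm : ContDiff ℝ (⊤ : ℕ∞) fun p : (Fin n → ℝ) × (Fin n → ℝ) =>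
      radialBump (p + (-(r⁻¹ • x), η)) := contDiff_radialBump.comp (by fun_prop)
  rw [heq, L.iteratedFDeriv_comp_right hsm t (by exact_mod_cast le_top),
    iteratedFDeriv_comp_add_right]
  refine (ContinuousMultilinearMap.norm_compContinuousLinearMap_le _ _).trans ?_
  rw [Finset.prod_const, Finset.card_univ, Fintype.card_fin, div_eq_mul_inv, ← inv_pow]
  have h1 : ‖L‖ ^ i ≤ r⁻¹ ^ N :=
    (pow_le_pow_left₀ (norm_nonneg _) hL i).trans
      (pow_le_pow_right₀ (by rw [one_le_inv₀ hr]; exact hr1) hi)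
  refine mul_le_mul ?_ h1 (by positivity) (Finset.sum_nonneg fun i _ => abs_nonneg _)
  refine ((hQ i _).trans (le_abs_self _)).trans ?_
  exact Finset.single_le_sum (f := fun i => |Q i|) (fun i _ => abs_nonneg _)
    (Finset.mem_range.2 (by omega))

/-- `g` grows at most like `r ^ (-M)` in terms of the distance `r` to the boundary of the cone. -/
def PolynomialGrowth (C : Set (Fin n → ℝ)) (δ K : ℝ) (M : ℕ) (g : (Fin n → ℂ) → ℂ) : Prop :=
  ∀ z : Fin n → ℂ, ∀ r, 0 < r → r ≤ δ → ‖reVec z‖ < δ →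
    Metric.ball (imVec z) r ⊆ C ∩ Metric.ball 0 δ → ‖g z‖ ≤ K / r ^ M

/-- A holomorphic function on a tube whose boundary value exists as a distribution grows at most
polynomially at the boundary. -/
theorem exists_polynomial_growth {C : Set (Fin n → ℝ)} {R : ℝ} (hR : 0 < R)
    {f : (Fin n → ℂ) → ℂ} (hf : DifferentiableOn ℂ f (tube C R)) (hlim : HasLocalLimit C R f) :
    ∃ δ > 0, δ ≤ R / 4 ∧ ∃ K ≥ 0, ∃ M : ℕ, PolynomialGrowth C δ K M f := by
  obtain ⟨N, δ₀, hδ₀, hδ₀R, A, hA0, hA⟩ :=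
    exists_uniform_bound (R' := R / 2) (by linarith) hf.continuousOn hlim hR
  obtain ⟨Q, hQ0, hQ⟩ := exists_iteratedFDeriv_radialBump_le (n := n) N
  set d := Module.finrank ℝ (Fin n → ℂ) with hd
  set ψ : ℝ → (Fin n → ℂ) → ℝ := fun r ζ => radialBump (r⁻¹ • reVec ζ, r⁻¹ • imVec ζ) with hψ
  have hψc : ∀ r, Continuous (ψ r) := fun r => contDiff_radialBump.continuous.comp (by fun_prop)
  have hψs : ∀ r > 0, Function.support (ψ r) ⊆ Metric.closedBall 0 (r / 2) := by
    intro r hr ζ hζ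
    have h1 := norm_le_of_radialBump_ne_zero hζ
    have h2 : toComplex (r⁻¹ • reVec ζ) (r⁻¹ • imVec ζ) = r⁻¹ • ζ := by
      ext j; apply Complex.ext <;> simp [toComplex, reVec, imVec]
    simp only [h2, norm_smul, norm_inv, Real.norm_of_nonneg hr.le] at h1
    rw [inv_mul_le_iff₀ hr] at h1
    rw [mem_closedBall_zero_iff]; linarith
  set J : ℝ := ∫ ζ, ψ 1 ζ with hJ
  have hJpos : 0 < J := by
    refine Continuous.integral_pos_of_hasCompactSupport_nonneg_nonzero (x := 0) (hψc 1) ?_ ?_ ?_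
    · refine HasCompactSupport.intro (isCompact_closedBall 0 (1 / 2)) fun ζ hζ => ?_
      by_contra h; exact hζ (hψs 1 one_pos h)
    · exact fun ζ => Real.smoothTransition.nonneg _
    · simp [hψ, radialBump]
  have hJr : ∀ r > 0, ∫ ζ, ψ r ζ = r ^ d * J := by
    intro r hr
    have h := Measure.integral_comp_inv_smul_of_nonneg (volume : Measure (Fin n → ℂ)) (ψ 1) hr.le
    rw [smul_eq_mul] at h
    rw [hJ, hd, ← h]
    congr 1; ext ζ
    simp only [hψ]
    congr 2 <;> ext j <;> simp [reVec, imVec]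
  set V : ℝ := (volume : Measure (Fin n → ℝ)).real (Metric.closedBall 0 1) with hV
  -- `R / 4` keeps the bumps around `reVec z` in the ball of radius `R / 2`, and `1` serves the
  -- derivative bounds. The exponent is `N` from the derivatives of the bump plus `d` from its mass
  -- `r ^ d * J`.
  refine ⟨min δ₀ (min (R / 4) 1), by positivity,
    (min_le_right _ _).trans (min_le_left _ _), A * Q * V / J, by positivity, N + d, ?_⟩
  intro z r hr hrδ hz hball
  have hr1 : r ≤ 1 := hrδ.trans ((min_le_right _ _).trans (min_le_right _ _))
  have hr4 : r ≤ R / 4 := hrδ.trans ((min_le_right _ _).trans (min_le_left _ _))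
  have hz4 : ‖reVec z‖ < R / 4 := hz.trans_le ((min_le_right _ _).trans (min_le_left _ _))
  have him : ∀ η : Fin n → ℝ, ‖η‖ < r → imVec z + η ∈ C ∧ ‖imVec z + η‖ < δ₀ := by
    intro η hη
    have : imVec z + η ∈ Metric.ball (imVec z) r := by simpa using hη
    have h := hball this
    exact ⟨h.1, (mem_ball_zero_iff.1 h.2).trans_le (min_le_left _ _)⟩
  have hsub : Metric.ball z r ⊆ tube C R := by
    intro w hw
    rw [mem_ball_iff_norm] at hw
    have h1 := him (imVec (w - z)) ((norm_imVec_le _).trans_lt hw)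
    have h2 : ‖reVec w‖ ≤ ‖reVec z‖ + ‖reVec (w - z)‖ := by
      simpa using norm_add_le (reVec z) (reVec (w - z))
    have h3 := (norm_reVec_le _).trans_lt hw
    simp only [imVec_sub, add_sub_cancel] at h1
    exact ⟨by linarith, h1.2.trans_le hδ₀R, h1.1⟩
  have hmean := integral_mul_eq_of_rotation_invariant (hf.mono hsub) (half_lt_self hr) (hψc r)
    (hψs r hr) fun c hc ζ => radialBump_smul hc ζ r⁻¹
  have hint : Integrable (fun ζ => (ψ r ζ : ℂ) * f (z + ζ)) := by
    have h1 : IntegrableOn (fun ζ => (ψ r ζ : ℂ) * f (z + ζ)) (Metric.closedBall 0 (r / 2)) := by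
      have hψr := hψc r
      refine ContinuousOn.integrableOn_compact (isCompact_closedBall _ _)
        (ContinuousOn.mul (by fun_prop) (hf.continuousOn.comp (by fun_prop) ?_))
      intro ζ hζ
      rw [mem_closedBall_zero_iff] at hζ
      refine hsub ?_
      rw [mem_ball_iff_norm, add_sub_cancel_left]; linarith
    refine (integrableOn_iff_integrable_of_support_subset fun ζ hζ => hψs r hr ?_).1 h1
    intro h; simp [h] at hζ
  -- Fubini: for a fixed imaginary displacement `η`, the integral over the real displacement is a
  -- pairing of `f(· + i(Im z + η))` with a test function, to which the uniform bound applies.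
  rw [← measurePreserving_toComplex.integral_comp measurableEmbedding_toComplex,
    Measure.volume_eq_prod, integral_prod_symm] at hmean
  swap
  · rw [← Measure.volume_eq_prod]
    exact (measurePreserving_toComplex.integrable_comp_emb measurableEmbedding_toComplex).2 hint
  have hinner : ∀ η : Fin n → ℝ,
      ∫ ξ, (ψ r (toComplex ξ η) : ℂ) * f (z + toComplex ξ η) =
        ∫ t, ((radialBump (r⁻¹ • (t - reVec z), r⁻¹ • η) : ℝ) : ℂ) *
          f (toComplex t (imVec z + η)) := by
    intro η
    rw [← integral_add_right_eq_self (fun t => ((radialBump (r⁻¹ • (t - reVec z), r⁻¹ • η) : ℝ) : ℂ) *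
      f (toComplex t (imVec z + η))) (reVec z)]
    congr 1; ext ξ
    rw [add_sub_cancel_right, add_comm ξ, ← toComplex_add_toComplex, toComplex_reVec_imVec]
    simp [hψ]
  simp only [hinner] at hmean
  have hout : ∀ η : Fin n → ℝ, r / 2 < ‖η‖ → ∀ t, radialBump (r⁻¹ • (t - reVec z), r⁻¹ • η) = 0 := by
    intro η hη t
    by_contra h
    have h1 : ψ r (toComplex (t - reVec z) η) ≠ 0 := by simpa [hψ] using h
    have h2 := mem_closedBall_zero_iff.1 (hψs r hr h1)
    have h3 := norm_imVec_le (toComplex (t - reVec z) η)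
    rw [imVec_toComplex] at h3
    linarith
  have hbound : ∀ η : Fin n → ℝ,
      ‖∫ t, ((radialBump (r⁻¹ • (t - reVec z), r⁻¹ • η) : ℝ) : ℂ) *
          f (toComplex t (imVec z + η))‖ ≤ A * (Q / r ^ N) := by
    intro η
    rcases lt_or_ge (r / 2) ‖η‖ with h | h
    · simp only [hout η h]
      simp only [Complex.ofReal_zero, zero_mul, integral_zero, norm_zero]
      positivity
    · have h1 := him η (by linarith)
      refine hA _ h1.1 h1.2 _ (contDiff_radialBump.comp (by fun_prop)) ?_ _ (by positivity)
        fun i hi t => hQ i hi r hr hr1 _ _ t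
      intro t ht
      have h1 : ψ r (toComplex (t - reVec z) η) ≠ 0 := by simpa [hψ] using ht
      have h2 := mem_closedBall_zero_iff.1 (hψs r hr h1)
      have h3 := norm_reVec_le (toComplex (t - reVec z) η)
      rw [reVec_toComplex] at h3
      have h4 := norm_add_le (t - reVec z) (reVec z)
      rw [sub_add_cancel] at h4
      rw [mem_closedBall_zero_iff]; linarith
  have hfin : ‖∫ η : Fin n → ℝ, ∫ t, ((radialBump (r⁻¹ • (t - reVec z), r⁻¹ • η) : ℝ) : ℂ) *
          f (toComplex t (imVec z + η))‖ ≤ A * (Q / r ^ N) * V := by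
    rw [← setIntegral_eq_integral_of_forall_compl_eq_zero (s := Metric.closedBall 0 1)]
    · exact norm_setIntegral_le_of_norm_le_const measure_closedBall_lt_top fun η _ => hbound η
    · intro η hη
      rw [mem_closedBall_zero_iff, not_le] at hη
      simp only [hout η (by linarith)]
      simp
  rw [hmean, hJr r hr, norm_mul, Complex.norm_real, Real.norm_of_nonneg (by positivity)] at hfin
  rw [le_div_iff₀ (by positivity)]
  have h5 : A * (Q / r ^ N) * V = A * Q * V / r ^ N := by ring
  rw [h5, le_div_iff₀ (by positivity)] at hfin
  rw [le_div_iff₀ hJpos, pow_add]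
  calc _ = r ^ d * J * ‖f z‖ * r ^ N := by ring
    _ ≤ _ := hfin

end Growth

/-! ### Mollification in the real directions -/

section Mollify

variable {n : ℕ}

theorem IsOpenCone.neBot {C : Set (Fin n → ℝ)} (hC : IsOpenCone C) (hne : C.Nonempty) :
    (𝓝[C] (0 : Fin n → ℝ)).NeBot := by
  obtain ⟨y, hy⟩ := hne
  rw [← mem_closure_iff_nhdsWithin_neBot]
  refine mem_closure_of_tendsto (f := fun k : ℕ => (1 / ((k : ℝ) + 1)) • y) (b := atTop) ?_
    (Eventually.of_forall fun k => hC.smul_mem y hy _ (by positivity))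
  simpa using (tendsto_one_div_add_atTop_nhds_zero_nat (𝕜 := ℝ)).smul_const y

/-- The average of `f` over real translations, with weight `φ`. -/
noncomputable def mollify (φ : (Fin n → ℝ) → ℝ) (f : (Fin n → ℂ) → ℂ) (z : Fin n → ℂ) : ℂ :=
  ∫ t, (φ t : ℂ) * f (z + ofRealVec t)

theorem mollify_eq (φ : (Fin n → ℝ) → ℝ) (f : (Fin n → ℂ) → ℂ) (z : Fin n → ℂ) :
    mollify φ f z = ∫ x, (φ (x - reVec z) : ℂ) * f (toComplex x (imVec z)) := by
  rw [← integral_add_right_eq_self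
    (fun x => (φ (x - reVec z) : ℂ) * f (toComplex x (imVec z))) (reVec z)]
  simp only [mollify, add_sub_cancel_right, add_ofRealVec, add_comm]

theorem measurable_mollify {φ : (Fin n → ℝ) → ℝ} (hφ : Continuous φ) {f : (Fin n → ℂ) → ℂ}
    (hf : Measurable f) : Measurable (mollify φ f) := by
  refine StronglyMeasurable.measurable ?_
  refine StronglyMeasurable.integral_prod_right
    (f := fun (z : Fin n → ℂ) t => (φ t : ℂ) * f (z + ofRealVec t)) ?_
  refine Measurable.stronglyMeasurable ?_
  have h1 : Measurable fun p : (Fin n → ℂ) × (Fin n → ℝ) => p.1 + ofRealVec p.2 :=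
    Continuous.measurable (by fun_prop)
  have h2 : Measurable fun p : (Fin n → ℂ) × (Fin n → ℝ) => (φ p.2 : ℂ) :=
    Continuous.measurable (by fun_prop)
  exact h2.mul (hf.comp h1)

theorem add_ofRealVec_mem_tube {C : Set (Fin n → ℝ)} {R ε : ℝ} {z : Fin n → ℂ}
    (hz : z ∈ tube C (R - ε)) {t : Fin n → ℝ} (ht : ‖t‖ ≤ ε) : z + ofRealVec t ∈ tube C R := by
  refine ⟨?_, ?_, ?_⟩
  · have := norm_add_le (reVec z) t
    have := hz.1
    rw [reVec_add, reVec_ofRealVec]; linarith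
  · have := hz.2.1
    have := (norm_nonneg t).trans ht
    rw [imVec_add, imVec_ofRealVec, add_zero]; linarith
  · rw [imVec_add, imVec_ofRealVec, add_zero]; exact hz.2.2

theorem differentiableOn_mollify {C : Set (Fin n → ℝ)} (hC : IsOpen C) {R ε : ℝ}
    {φ : (Fin n → ℝ) → ℝ} (hφ : Continuous φ)
    (hs : Function.support φ ⊆ Metric.closedBall 0 ε) {f : (Fin n → ℂ) → ℂ} (hfm : Measurable f)
    (hf : DifferentiableOn ℂ f (tube C R)) :
    DifferentiableOn ℂ (mollify φ f) (tube C (R - ε)) := by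
  intro z hz
  obtain ⟨s, hs0, hsub⟩ := Metric.nhds_basis_closedBall.mem_iff.1
    ((isOpen_tube hC (R - ε)).mem_nhds hz)
  have hK : IsCompact ((fun p : (Fin n → ℂ) × (Fin n → ℝ) => p.1 + ofRealVec p.2) ''
      (Metric.closedBall z s ×ˢ Metric.closedBall 0 ε)) :=
    ((isCompact_closedBall _ _).prod (isCompact_closedBall _ _)).image (by fun_prop)
  have hKsub : (fun p : (Fin n → ℂ) × (Fin n → ℝ) => p.1 + ofRealVec p.2) ''
      (Metric.closedBall z s ×ˢ Metric.closedBall 0 ε) ⊆ tube C R := by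
    rintro _ ⟨⟨w, t⟩, ⟨hw, ht⟩, rfl⟩
    exact add_ofRealVec_mem_tube (hsub hw) (mem_closedBall_zero_iff.1 ht)
  obtain ⟨B, hB⟩ := hK.exists_bound_of_continuousOn (hf.continuousOn.mono hKsub)
  have hsupp : ∀ t, ¬ ‖t‖ ≤ ε → φ t = 0 := fun t ht => by
    by_contra h; exact ht (mem_closedBall_zero_iff.1 (hs h))
  have hcs : HasCompactSupport φ := HasCompactSupport.intro (isCompact_closedBall 0 ε)
    fun t ht => hsupp t (by rwa [mem_closedBall_zero_iff] at ht)
  refine DifferentiableOn.differentiableAt (s := Metric.ball z s) ?_ (Metric.ball_mem_nhds _ hs0)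
    |>.differentiableWithinAt
  refine differentiableOn_integral_of_norm_le (b := fun t => ‖φ t‖ * B) Metric.isOpen_ball ?_ ?_
    ((hφ.integrable_of_hasCompactSupport hcs).norm.mul_const B) ?_
  · intro w _
    have h1 : Measurable fun t : Fin n → ℝ => w + ofRealVec t :=
      Continuous.measurable (by fun_prop)
    have h2 : Measurable fun t : Fin n → ℝ => (φ t : ℂ) := Continuous.measurable (by fun_prop)
    exact (h2.mul (hfm.comp h1)).aestronglyMeasurable
  · refine Eventually.of_forall fun t => ?_
    by_cases ht : ‖t‖ ≤ ε
    · refine DifferentiableOn.const_mul (hf.comp (by fun_prop) ?_) _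
      exact fun w hw => add_ofRealVec_mem_tube (hsub (Metric.ball_subset_closedBall hw)) ht
    · simp [hsupp t ht]
  · refine Eventually.of_forall fun t w hw => ?_
    rw [norm_mul, Complex.norm_real]
    by_cases ht : ‖t‖ ≤ ε
    · gcongr
      exact hB _ ⟨(w, t), ⟨Metric.ball_subset_closedBall hw, mem_closedBall_zero_iff.2 ht⟩, rfl⟩
    · simp [hsupp t ht]

theorem PolynomialGrowth.mono {C : Set (Fin n → ℝ)} {δ δ' K : ℝ} {M : ℕ}
    {g : (Fin n → ℂ) → ℂ} (h : PolynomialGrowth C δ K M g) (hδ : δ' ≤ δ) :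
    PolynomialGrowth C δ' K M g := fun z r hr hrδ hz hb =>
  h z r hr (hrδ.trans hδ) (hz.trans_le hδ)
    (hb.trans (inter_subset_inter_right _ (Metric.ball_subset_ball hδ)))

/-- Real translations do not change the imaginary part, and the weight has mass one. The constants
`K` and `M` are thus independent of `φ`, as dominated convergence later requires. -/
theorem PolynomialGrowth.mollify {C : Set (Fin n → ℝ)} {δ K ε : ℝ} {M : ℕ}
    {f : (Fin n → ℂ) → ℂ} (h : PolynomialGrowth C δ K M f)
    {φ : (Fin n → ℝ) → ℝ} (hφ : Continuous φ) (hs : Function.support φ ⊆ Metric.closedBall 0 ε)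
    (hε : 0 ≤ ε) (h0 : ∀ t, 0 ≤ φ t) (h1 : ∫ t, φ t = 1) :
    PolynomialGrowth C (δ - ε) K M (mollify φ f) := by
  intro z r hr hrδ hz hb
  have hsupp : ∀ t, ¬ ‖t‖ ≤ ε → φ t = 0 := fun t ht => by
    by_contra h; exact ht (mem_closedBall_zero_iff.1 (hs h))
  have hcs : HasCompactSupport φ := HasCompactSupport.intro (isCompact_closedBall 0 ε)
    fun t ht => hsupp t (by rwa [mem_closedBall_zero_iff] at ht)
  calc ‖EdgeOfWedge.mollify φ f z‖ ≤ ∫ t, φ t * (K / r ^ M) := by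
        refine norm_integral_le_of_norm_le
          ((hφ.integrable_of_hasCompactSupport hcs).mul_const _) (Eventually.of_forall fun t => ?_)
        rw [norm_mul, Complex.norm_real, Real.norm_of_nonneg (h0 t)]
        by_cases ht : ‖t‖ ≤ ε
        · refine mul_le_mul_of_nonneg_left (h _ r hr (by linarith) ?_ ?_) (h0 t)
          · have := norm_add_le (reVec z) t
            rw [reVec_add, reVec_ofRealVec]; linarith
          · rw [imVec_add, imVec_ofRealVec, add_zero]
            exact hb.trans (inter_subset_inter_right _ (Metric.ball_subset_ball (by linarith)))
        · simp [hsupp t ht]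
    _ = K / r ^ M := by rw [integral_mul_const, h1, one_mul]

/-- Makes translates of `φ` depend in a Lipschitz way on the translation, in the seminorm of the
uniform bound. -/
theorem exists_lipschitz_iteratedFDeriv {φ : (Fin n → ℝ) → ℝ} (hφ : ContDiff ℝ (⊤ : ℕ∞) φ)
    (hcs : HasCompactSupport φ) (N : ℕ) :
    ∃ L ≥ 0, ∀ i ≤ N, ∀ x y,
      ‖iteratedFDeriv ℝ i φ x - iteratedFDeriv ℝ i φ y‖ ≤ L * ‖x - y‖ := by
  have h : ∀ i : ℕ, ∃ L : NNReal, LipschitzWith L (iteratedFDeriv ℝ i φ) := fun i =>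
    ContDiff.lipschitzWith_of_hasCompactSupport (𝕂 := ℝ) (hcs.iteratedFDeriv i)
      (hφ.iteratedFDeriv_right (m := 1) (by exact_mod_cast le_top)) one_ne_zero
  choose L hL using h
  refine ⟨∑ i ∈ Finset.range (N + 1), (L i : ℝ), Finset.sum_nonneg fun i _ => (L i).2, ?_⟩
  intro i hi x y
  refine ((hL i).norm_sub_le x y).trans ?_
  gcongr
  exact Finset.single_le_sum (f := fun i => (L i : ℝ)) (fun i _ => (L i).2)
    (Finset.mem_range.2 (by omega))

/-- The points of `ℝⁿ + i(C ∪ 0)` whose real and imaginary parts have norm less than `δ`. -/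
def closedTube (C : Set (Fin n → ℝ)) (δ : ℝ) : Set (Fin n → ℂ) :=
  {z | ‖reVec z‖ < δ ∧ ‖imVec z‖ < δ ∧ (imVec z = 0 ∨ imVec z ∈ C)}

/-- Mollification of a function that has a boundary value as a distribution gives a function that is
continuous up to the boundary. -/
theorem exists_continuous_extension {C : Set (Fin n → ℝ)} (hC : IsOpenCone C) (hne : C.Nonempty)
    (h0 : (0 : Fin n → ℝ) ∉ C) {R : ℝ} (hR : 0 < R) {f : (Fin n → ℂ) → ℂ} (hfm : Measurable f)
    (hf : DifferentiableOn ℂ f (tube C R)) (hlim : HasLocalLimit C R f) :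
    ∃ δ > 0, δ ≤ R / 4 ∧ ∀ φ : (Fin n → ℝ) → ℝ, ContDiff ℝ (⊤ : ℕ∞) φ →
      Function.support φ ⊆ Metric.closedBall 0 (R / 4) →
      ∃ P : (Fin n → ℂ) → ℂ, (∀ z, imVec z ∈ C → P z = mollify φ f z) ∧
        ContinuousOn P (closedTube C δ) := by
  classical
  have := hC.neBot hne
  obtain ⟨N, δ₀, hδ₀, hδ₀R, A, hA0, hA⟩ :=
    exists_uniform_bound (R' := R / 2) (by linarith) hf.continuousOn hlim hR
  refine ⟨min δ₀ (R / 4), by positivity, min_le_right _ _, fun φ hφ hs => ?_⟩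
  have hcs : HasCompactSupport φ := HasCompactSupport.intro (isCompact_closedBall 0 (R / 4))
    fun t ht => by by_contra h; exact ht (hs h)
  obtain ⟨L, hL0, hL⟩ := exists_lipschitz_iteratedFDeriv hφ hcs N
  have hshift : ∀ x : Fin n → ℝ, ContDiff ℝ (⊤ : ℕ∞) fun t => φ (t - x) := fun x =>
    hφ.comp (by fun_prop)
  have hsupp : ∀ x : Fin n → ℝ, ‖x‖ ≤ R / 4 →
      Function.support (fun t => φ (t - x)) ⊆ Metric.closedBall 0 (R / 2) := by
    intro x hx t ht
    have h1 := mem_closedBall_zero_iff.1 (hs ht)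
    have h2 := norm_add_le (t - x) x
    rw [sub_add_cancel] at h2
    rw [mem_closedBall_zero_iff]; linarith
  have hcont : ∀ Y ∈ C, ‖Y‖ < R →
      ContinuousOn (fun t => f (toComplex t Y)) (Metric.closedBall 0 (R / 2)) := by
    intro Y hY hYR
    refine hf.continuousOn.comp (by fun_prop) fun t ht => ?_
    rw [mem_closedBall_zero_iff] at ht
    exact ⟨by rw [reVec_toComplex]; linarith, by simpa using hYR, by simpa using hY⟩
  -- The difference of two translates of `φ` is a test function of size `L * ‖x - x'‖`, so the
  -- Lipschitz constant in `x` does not depend on `Y`.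
  have hLip : ∀ Y ∈ C, ‖Y‖ < δ₀ → ∀ x x' : Fin n → ℝ, ‖x‖ ≤ R / 4 → ‖x'‖ ≤ R / 4 →
      ‖mollify φ f (toComplex x Y) - mollify φ f (toComplex x' Y)‖ ≤ A * (L * ‖x - x'‖) := by
    intro Y hY hYδ x x' hx hx'
    rw [mollify_eq, mollify_eq]
    simp only [reVec_toComplex, imVec_toComplex]
    have hc := hcont Y hY (hYδ.trans_le hδ₀R)
    rw [← integral_sub (integrable_mul_of_support (hshift x).continuous (hsupp x hx) hc)
      (integrable_mul_of_support (hshift x').continuous (hsupp x' hx') hc)]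
    have := hA Y hY hYδ (fun t => φ (t - x) - φ (t - x')) ((hshift x).sub (hshift x')) (by
        refine (Function.support_sub _ _).trans (union_subset (hsupp x hx) (hsupp x' hx')))
      (L * ‖x - x'‖) (by positivity) (by
        intro i hi t
        have e : (fun t => φ (t - x) - φ (t - x')) =
          (fun t => φ (t - x)) - fun t => φ (t - x') := rfl
        rw [e, iteratedFDeriv_sub_apply
          (((hshift x).of_le (by exact_mod_cast le_top)).contDiffAt)
          (((hshift x').of_le (by exact_mod_cast le_top)).contDiffAt),
          iteratedFDeriv_comp_sub, iteratedFDeriv_comp_sub]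
        refine (hL i hi _ _).trans_eq ?_
        rw [sub_sub_sub_cancel_left, norm_sub_rev])
    refine le_trans (le_of_eq ?_) this
    congr 2; ext t
    push_cast; ring
  have hlim' : ∀ x : Fin n → ℝ, ∃ c, ‖x‖ ≤ R / 4 →
      Tendsto (fun Y => mollify φ f (toComplex x Y)) (𝓝[C] 0) (𝓝 c) := by
    intro x
    by_cases hx : ‖x‖ ≤ R / 4
    · obtain ⟨c, hc⟩ := hlim (R / 2) (by linarith) _ (hshift x) (hsupp x hx)
      refine ⟨c, fun _ => hc.congr fun Y => ?_⟩
      rw [mollify_eq]; simp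
    · exact ⟨0, fun h => absurd h hx⟩
  choose p hp using hlim'
  have hpLip : ∀ x x' : Fin n → ℝ, ‖x‖ ≤ R / 4 → ‖x'‖ ≤ R / 4 →
      ‖p x - p x'‖ ≤ A * (L * ‖x - x'‖) := by
    intro x x' hx hx'
    refine le_of_tendsto ((hp x hx).sub (hp x' hx')).norm ?_
    filter_upwards [self_mem_nhdsWithin, nhdsWithin_le_nhds (Metric.ball_mem_nhds _ hδ₀)]
      with Y hY hYδ
    exact hLip Y hY (mem_ball_zero_iff.1 hYδ) x x' hx hx'
  refine ⟨fun z => if imVec z = 0 then p (reVec z) else mollify φ f z, ?_, ?_⟩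
  · intro z hz
    exact if_neg fun h : imVec z = 0 => h0 (h ▸ hz)
  · intro z hz
    rcases hz.2.2 with hz0 | hzC
    -- At an edge point, move first in the real direction by the uniform Lipschitz bound, then in
    -- the imaginary direction by the limit that defines `p`.
    · rw [Metric.continuousWithinAt_iff]
      intro ε hε
      have hzR : ‖reVec z‖ ≤ R / 4 := (hz.1.trans_le (min_le_right _ _)).le
      obtain ⟨η, hη, hηC⟩ := Metric.mem_nhdsWithin_iff.1
        ((hp _ hzR).eventually (Metric.ball_mem_nhds _ (half_pos hε)))
      refine ⟨min η (ε / 2 / (A * L + 1)), by positivity, fun {w} hw hwz => ?_⟩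
      have hwR : ‖reVec w‖ ≤ R / 4 := (hw.1.trans_le (min_le_right _ _)).le
      rw [dist_eq_norm] at hwz
      have h1 : A * (L * ‖reVec w - reVec z‖) < ε / 2 := by
        have h2 : ‖reVec w - reVec z‖ ≤ ε / 2 / (A * L + 1) := by
          rw [← reVec_sub]
          exact (norm_reVec_le _).trans (hwz.le.trans (min_le_right _ _))
        rw [le_div_iff₀ (by positivity)] at h2
        rcases (norm_nonneg (reVec w - reVec z)).eq_or_lt with h | h
        · rw [← h]; simp; exact hε
        · nlinarith
      simp only [hz0, if_true]
      rcases hw.2.2 with hw0 | hwC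
      · simp only [hw0, if_true]
        rw [dist_eq_norm]
        linarith [hpLip _ _ hwR hzR]
      · have hne0 : imVec w ≠ 0 := fun h => h0 (h ▸ hwC)
        simp only [hne0, if_false]
        have h3 := hLip _ hwC (hw.2.1.trans_le (min_le_left _ _)) _ _ hwR hzR
        rw [toComplex_reVec_imVec] at h3
        have h4 : imVec w ∈ Metric.ball 0 η := by
          rw [mem_ball_zero_iff]
          have : imVec w = imVec (w - z) := by rw [imVec_sub, hz0, sub_zero]
          rw [this]
          exact (norm_imVec_le _).trans_lt (hwz.trans_le (min_le_left _ _))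
        have h5 : ‖mollify φ f (toComplex (reVec z) (imVec w)) - p (reVec z)‖ < ε / 2 := by
          have := hηC ⟨h4, hwC⟩
          simpa [dist_eq_norm] using this
        calc _ ≤ ‖mollify φ f w - mollify φ f (toComplex (reVec z) (imVec w))‖ +
              ‖mollify φ f (toComplex (reVec z) (imVec w)) - p (reVec z)‖ := by
                rw [dist_eq_norm]; exact norm_sub_le_norm_sub_add_norm_sub _ _ _
          _ < ε := by linarith
    · refine ContinuousAt.continuousWithinAt ?_
      have hmem : z ∈ tube C (R - R / 4) :=
        ⟨by linarith [hz.1.trans_le (min_le_right _ _)],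
          by linarith [hz.2.1.trans_le (min_le_right _ _)], hzC⟩
      have hopen := (isOpen_tube hC.isOpen (R - R / 4)).mem_nhds hmem
      refine (((differentiableOn_mollify hC.isOpen hφ.continuous hs hfm hf).continuousOn).continuousAt
        hopen).congr ?_
      filter_upwards [hopen] with w hw
      exact (if_neg fun h : imVec w = 0 => h0 (h ▸ hw.2.2)).symm

end Mollify

/-! ### Averages over discs with boundary in the wedge -/

section WedgeAverage

variable {n : ℕ}

/-- A polynomial disc centred at `w`, in the variable `c`, whose boundary circle lies in the wedge
except for two points. -/
noncomputable def wedgeDisc (κ : ℝ) (e : Fin n → ℝ) (w : Fin n → ℂ) (c : ℂ) : Fin n → ℂ :=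
  (1 - c ^ 2) • w + ((κ : ℂ) * c) • ofRealVec e

/-- A weighted average of `g` over the boundary of a polynomial disc centred at `w`. -/
noncomputable def wedgeAverage (κ : ℝ) (e : Fin n → ℝ) (M : ℕ) (g : (Fin n → ℂ) → ℂ)
    (w : Fin n → ℂ) : ℂ :=
  Real.circleAverage (fun c => g (wedgeDisc κ e w c) * (1 - c ^ 2) ^ M) 0 1

theorem continuous_wedgeDisc (κ : ℝ) (e : Fin n → ℝ) (w : Fin n → ℂ) :
    Continuous (wedgeDisc κ e w) := by
  unfold wedgeDisc; fun_prop

theorem imVec_wedgeDisc_of_norm_eq_one (κ : ℝ) (e : Fin n → ℝ) (w : Fin n → ℂ) {c : ℂ}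
    (hc : ‖c‖ = 1) :
    imVec (wedgeDisc κ e w c) = c.im • (κ • e - (2 : ℝ) • reVec (c • w)) := by
  have h : c.re * c.re + c.im * c.im = 1 := by
    rw [← Complex.normSq_apply, Complex.normSq_eq_norm_sq, hc, one_pow]
  ext j
  simp [wedgeDisc, imVec, reVec, ofRealVec, pow_two]
  linear_combination (-(w j).im) * h

theorem imVec_wedgeDisc_ofRealVec (κ : ℝ) (e x : Fin n → ℝ) (c : ℂ) :
    imVec (wedgeDisc κ e (ofRealVec x) c) = c.im • (κ • e - (2 * c.re) • x) := by
  ext j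
  simp [wedgeDisc, imVec, ofRealVec, pow_two]
  ring

theorem norm_wedgeDisc_le {κ : ℝ} (hκ : 0 ≤ κ) (e : Fin n → ℝ) (w : Fin n → ℂ) {c : ℂ}
    (hc : ‖c‖ ≤ 1) : ‖wedgeDisc κ e w c‖ ≤ 2 * ‖w‖ + κ * ‖e‖ := by
  have h1 : ‖1 - c ^ 2‖ ≤ 2 := by
    refine (norm_sub_le _ _).trans ?_
    rw [norm_one, norm_pow]
    have := pow_le_one₀ (n := 2) (norm_nonneg c) hc
    linarith
  refine (norm_add_le _ _).trans (add_le_add ?_ ?_)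
  · rw [norm_smul]; gcongr
  · rw [norm_smul, norm_mul, Complex.norm_real, Real.norm_of_nonneg hκ, norm_ofRealVec]
    gcongr
    exact mul_le_of_le_one_right hκ hc

/-- The symmetry of the cone enters here: negative multiples are allowed, so both halves of the
boundary circle of a disc are admissible. -/
theorem IsOpenCone.smul_mem_of_norm_sub_lt {C : Set (Fin n → ℝ)} (hC : IsOpenCone C)
    (hsymm : ∀ y, y ∈ C ↔ -y ∈ C) {e : Fin n → ℝ} {ρ : ℝ} (he : Metric.ball e ρ ⊆ C) {κ : ℝ}
    (hκ : 0 < κ) {v : Fin n → ℝ} (hv : ‖v - κ • e‖ < κ * ρ) {s : ℝ} (hs : s ≠ 0) : s • v ∈ C := by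
  have h1 : κ⁻¹ • v ∈ C := by
    refine he ?_
    have : κ⁻¹ • v - e = κ⁻¹ • (v - κ • e) := by
      rw [smul_sub, smul_smul, inv_mul_cancel₀ hκ.ne', one_smul]
    rw [mem_ball_iff_norm, this, norm_smul, norm_inv, Real.norm_of_nonneg hκ.le,
      inv_mul_lt_iff₀ hκ]
    exact hv
  have h2 : ∀ t : ℝ, 0 < t → t • v ∈ C := by
    intro t ht
    have := hC.smul_mem _ h1 (t * κ) (by positivity)
    rwa [smul_smul, mul_assoc, mul_inv_cancel₀ hκ.ne', mul_one] at this
  rcases lt_or_gt_of_ne hs with h | h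
  · rw [hsymm, ← neg_smul]
    exact h2 _ (by linarith)
  · exact h2 s h

theorem IsOpenCone.ball_smul_subset {C : Set (Fin n → ℝ)} (hC : IsOpenCone C)
    (hsymm : ∀ y, y ∈ C ↔ -y ∈ C) {e : Fin n → ℝ} {ρ : ℝ} (he : Metric.ball e ρ ⊆ C) {κ : ℝ}
    (hκ : 0 < κ) {v : Fin n → ℝ} (hv : ‖v - κ • e‖ ≤ κ * ρ / 2) {s : ℝ} (hs : s ≠ 0) :
    Metric.ball (s • v) (|s| * (κ * ρ / 2)) ⊆ C := by
  intro y hy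
  rw [mem_ball_iff_norm] at hy
  have h1 : y = s • (s⁻¹ • y) := by rw [smul_smul, mul_inv_cancel₀ hs, one_smul]
  rw [h1]
  refine hC.smul_mem_of_norm_sub_lt hsymm he hκ ?_ hs
  have h2 : s⁻¹ • y - v = s⁻¹ • (y - s • v) := by
    rw [smul_sub, smul_smul, inv_mul_cancel₀ hs, one_smul]
  have h3 : ‖s⁻¹ • y - v‖ < κ * ρ / 2 := by
    rw [h2, norm_smul, norm_inv, Real.norm_eq_abs, inv_mul_lt_iff₀ (abs_pos.2 hs)]
    exact hy
  linarith [norm_sub_le_norm_sub_add_norm_sub (s⁻¹ • y) v (κ • e)]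

theorem norm_one_sub_sq_of_norm_eq_one {c : ℂ} (hc : ‖c‖ = 1) : ‖1 - c ^ 2‖ = 2 * |c.im| := by
  have h : c.re * c.re + c.im * c.im = 1 := by
    rw [← Complex.normSq_apply, Complex.normSq_eq_norm_sq, hc, one_pow]
  have h1 : ‖1 - c ^ 2‖ ^ 2 = (2 * |c.im|) ^ 2 := by
    rw [← Complex.normSq_eq_norm_sq, Complex.normSq_apply, mul_pow, sq_abs]
    simp [pow_two]
    linear_combination (c.re * c.re + c.im * c.im - 1) * h
  exact (sq_eq_sq₀ (norm_nonneg _) (by positivity)).1 h1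

theorem ae_im_circleMap_ne_zero (μ : Measure ℝ) [NullSingletonClass μ] :
    ∀ᵐ θ ∂μ, (circleMap 0 1 θ).im ≠ 0 := by
  have h : (range fun k : ℤ => (k : ℝ) * Real.pi).Countable := countable_range _
  filter_upwards [h.ae_notMem μ] with θ hθ h0
  refine hθ ?_
  have : Real.sin θ = 0 := by
    simpa [circleMap, Complex.exp_im] using h0
  exact Real.sin_eq_zero_iff.1 this

/-- The geometric data for an average over discs: a ball in the cone, and a scale. -/
structure IsWedgeScale (C : Set (Fin n → ℝ)) (δ κ ρ : ℝ) (e : Fin n → ℝ) : Prop where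
  isOpenCone : IsOpenCone C
  symm : ∀ y, y ∈ C ↔ -y ∈ C
  ball_subset : Metric.ball e ρ ⊆ C
  κ_pos : 0 < κ
  ρ_pos : 0 < ρ
  lt : κ * (‖e‖ + ρ) < δ

variable {C : Set (Fin n → ℝ)} {δ κ ρ K : ℝ} {e : Fin n → ℝ} {M : ℕ} {g : (Fin n → ℂ) → ℂ}

theorem IsWedgeScale.norm_wedgeDisc_lt (h : IsWedgeScale C δ κ ρ e) {w : Fin n → ℂ}
    (hw : ‖w‖ < κ * ρ / 4) {c : ℂ} (hc : ‖c‖ ≤ 1) : ‖wedgeDisc κ e w c‖ < δ := by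
  have := norm_wedgeDisc_le h.κ_pos.le e w hc
  have := mul_pos h.κ_pos h.ρ_pos
  linarith [h.lt, mul_add κ ‖e‖ ρ]

/-- The perturbation `2 Re (c w)` uses up at most half of the room `κ * ρ` around `κ • e`; the other
half, scaled by `|c.im|`, is the distance left to the boundary of the cone. -/
theorem IsWedgeScale.ball_subset_of_norm_eq_one (h : IsWedgeScale C δ κ ρ e) {w : Fin n → ℂ}
    (hw : ‖w‖ < κ * ρ / 4) {c : ℂ} (hc : ‖c‖ = 1) (hc0 : c.im ≠ 0) :
    Metric.ball (imVec (wedgeDisc κ e w c)) (|c.im| * (κ * ρ / 2)) ⊆ C ∩ Metric.ball 0 δ := by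
  have hκρ := mul_pos h.κ_pos h.ρ_pos
  have h1 : ‖(2 : ℝ) • reVec (c • w)‖ ≤ κ * ρ / 2 := by
    have := norm_reVec_le (c • w)
    rw [norm_smul c w, hc, one_mul] at this
    rw [norm_smul, Real.norm_of_nonneg zero_le_two]; linarith
  rw [imVec_wedgeDisc_of_norm_eq_one κ e w hc]
  refine subset_inter (h.isOpenCone.ball_smul_subset h.symm h.ball_subset h.κ_pos ?_ hc0) ?_
  · rwa [sub_sub_cancel_left, norm_neg]
  · refine Metric.ball_subset_ball' ?_
    have h2 : |c.im| ≤ 1 := hc ▸ Complex.abs_im_le_norm c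
    have h3 : ‖κ • e - (2 : ℝ) • reVec (c • w)‖ ≤ κ * ‖e‖ + κ * ρ / 2 := by
      refine (norm_sub_le _ _).trans (add_le_add ?_ h1)
      rw [norm_smul, Real.norm_of_nonneg h.κ_pos.le]
    rw [dist_zero_right, norm_smul, Real.norm_eq_abs]
    have h4 : |c.im| * (κ * ρ / 2) ≤ κ * ρ / 2 := mul_le_of_le_one_left (by positivity) h2
    have h5 := mul_le_of_le_one_left (norm_nonneg (κ • e - (2 : ℝ) • reVec (c • w))) h2
    linarith [h.lt, mul_add κ ‖e‖ ρ]

theorem IsWedgeScale.mem_tube_of_norm_eq_one (h : IsWedgeScale C δ κ ρ e) {w : Fin n → ℂ}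
    (hw : ‖w‖ < κ * ρ / 4) {c : ℂ} (hc : ‖c‖ = 1) (hc0 : c.im ≠ 0) :
    wedgeDisc κ e w c ∈ tube C δ := by
  have hκρ := mul_pos h.κ_pos h.ρ_pos
  have h1 := h.norm_wedgeDisc_lt hw hc.le
  refine ⟨(norm_reVec_le _).trans_lt h1, (norm_imVec_le _).trans_lt h1,
    (h.ball_subset_of_norm_eq_one hw hc hc0 (Metric.mem_ball_self ?_)).1⟩
  have := abs_pos.2 hc0
  positivity

/-- The growth bound at distance `|c.im| * (κ * ρ / 2)` is compensated exactly by `‖1 - c ^ 2‖ ^ M =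
(2 * |c.im|) ^ M`. -/
theorem IsWedgeScale.norm_integrand_le (h : IsWedgeScale C δ κ ρ e)
    (hg : PolynomialGrowth C δ K M g) {w : Fin n → ℂ} (hw : ‖w‖ < κ * ρ / 4) {c : ℂ}
    (hc : ‖c‖ = 1) (hc0 : c.im ≠ 0) :
    ‖g (wedgeDisc κ e w c) * (1 - c ^ 2) ^ M‖ ≤ K * (4 / (κ * ρ)) ^ M := by
  have hκρ := mul_pos h.κ_pos h.ρ_pos
  have hpos := abs_pos.2 hc0
  have h2 : |c.im| ≤ 1 := hc ▸ Complex.abs_im_le_norm c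
  have h4 : |c.im| * (κ * ρ / 2) ≤ κ * ρ / 2 := mul_le_of_le_one_left (by positivity) h2
  have h5 : κ * ρ / 2 ≤ δ := by
    have := mul_nonneg h.κ_pos.le (norm_nonneg e)
    linarith [h.lt, mul_add κ ‖e‖ ρ]
  have h1 := hg (wedgeDisc κ e w c) (|c.im| * (κ * ρ / 2)) (by positivity) (h4.trans h5)
    ((norm_reVec_le _).trans_lt (h.norm_wedgeDisc_lt hw hc.le))
    (h.ball_subset_of_norm_eq_one hw hc hc0)
  rw [norm_mul, norm_pow, norm_one_sub_sq_of_norm_eq_one hc]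
  calc _ ≤ K / (|c.im| * (κ * ρ / 2)) ^ M * (2 * |c.im|) ^ M := by gcongr
    _ = K * (4 / (κ * ρ)) ^ M := by
      rw [div_mul_eq_mul_div, mul_div_assoc, ← div_pow]
      congr 2
      field_simp
      norm_num

theorem measurable_wedgeAverage_integrand (hg : Measurable g) (w : Fin n → ℂ) :
    Measurable fun θ : ℝ =>
      g (wedgeDisc κ e w (circleMap 0 1 θ)) * (1 - circleMap 0 1 θ ^ 2) ^ M := by
  have h1 : Continuous (circleMap 0 1) := continuous_circleMap 0 1
  have h2 : Measurable fun θ : ℝ => (1 - circleMap 0 1 θ ^ 2) ^ M :=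
    Continuous.measurable (by fun_prop)
  exact (hg.comp ((continuous_wedgeDisc κ e w).comp h1).measurable).mul h2

theorem differentiableOn_wedgeAverage (h : IsWedgeScale C δ κ ρ e) (hgm : Measurable g)
    (hgd : DifferentiableOn ℂ g (tube C δ)) (hg : PolynomialGrowth C δ K M g) :
    DifferentiableOn ℂ (wedgeAverage κ e M g) (Metric.ball 0 (κ * ρ / 4)) := by
  have hopen := isOpen_tube h.isOpenCone.isOpen δ
  unfold wedgeAverage
  simp only [Real.circleAverage_def, intervalIntegral.integral_of_le Real.two_pi_pos.le,
    Complex.real_smul]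
  refine DifferentiableOn.const_mul ?_ _
  refine differentiableOn_integral_of_norm_le (b := fun _ => K * (4 / (κ * ρ)) ^ M)
    Metric.isOpen_ball ?_ ?_ (integrable_const _) ?_
  · exact fun w _ => (measurable_wedgeAverage_integrand hgm w).aestronglyMeasurable
  · filter_upwards [ae_im_circleMap_ne_zero _] with θ hθ w hw
    rw [mem_ball_zero_iff] at hw
    have h1 := (hgd.differentiableAt
      (hopen.mem_nhds (h.mem_tube_of_norm_eq_one hw (by simp) hθ)))
    have h2 : DifferentiableAt ℂ (fun w => wedgeDisc κ e w (circleMap 0 1 θ)) w := by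
      unfold wedgeDisc; fun_prop
    exact ((h1.comp w h2).mul_const _).differentiableWithinAt
  · filter_upwards [ae_im_circleMap_ne_zero _] with θ hθ w hw
    exact h.norm_integrand_le hg (mem_ball_zero_iff.1 hw) (by simp) hθ

theorem tendsto_wedgeAverage (h : IsWedgeScale C δ κ ρ e) {G : ℕ → (Fin n → ℂ) → ℂ}
    (hGm : ∀ k, Measurable (G k)) (hG : ∀ k, PolynomialGrowth C δ K M (G k))
    (hlim : ∀ z ∈ tube C δ, Tendsto (fun k => G k z) atTop (𝓝 (g z))) {w : Fin n → ℂ}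
    (hw : ‖w‖ < κ * ρ / 4) :
    Tendsto (fun k => wedgeAverage κ e M (G k) w) atTop (𝓝 (wedgeAverage κ e M g w)) := by
  simp only [wedgeAverage, Real.circleAverage_def]
  refine Tendsto.const_smul ?_ _
  refine intervalIntegral.tendsto_integral_filter_of_dominated_convergence
    (fun _ => K * (4 / (κ * ρ)) ^ M) ?_ ?_ (intervalIntegrable_const) ?_
  · exact Eventually.of_forall fun k =>
      (measurable_wedgeAverage_integrand (hGm k) w).aestronglyMeasurable
  · refine Eventually.of_forall fun k => ?_
    filter_upwards [ae_im_circleMap_ne_zero _] with θ hθ _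
    exact h.norm_integrand_le (hG k) hw (by simp) hθ
  · filter_upwards [ae_im_circleMap_ne_zero _] with θ hθ _
    exact (hlim _ (h.mem_tube_of_norm_eq_one hw (by simp) hθ)).mul_const _

/-- For a real centre the imaginary part is `c.im • (κ • e - (2 * c.re) • x)` on the whole closed
disc, not only on the circle, so the interior stays over the cone as well. -/
theorem IsWedgeScale.mem_closedTube_of_real (h : IsWedgeScale C δ κ ρ e) {x : Fin n → ℝ}
    (hx : ‖x‖ < κ * ρ / 4) {c : ℂ} (hc : ‖c‖ ≤ 1) :
    wedgeDisc κ e (ofRealVec x) c ∈ closedTube C δ ∧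
      (c.im ≠ 0 → imVec (wedgeDisc κ e (ofRealVec x) c) ∈ C) := by
  have hκρ := mul_pos h.κ_pos h.ρ_pos
  have h1 := h.norm_wedgeDisc_lt (w := ofRealVec x) (by rwa [norm_ofRealVec]) hc
  have h2 : c.im ≠ 0 → imVec (wedgeDisc κ e (ofRealVec x) c) ∈ C := by
    intro hc0
    rw [imVec_wedgeDisc_ofRealVec]
    refine h.isOpenCone.smul_mem_of_norm_sub_lt h.symm h.ball_subset h.κ_pos ?_ hc0
    rw [sub_sub_cancel_left, norm_neg, norm_smul, norm_mul, Real.norm_of_nonneg zero_le_two,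
      Real.norm_eq_abs]
    have h3 := (Complex.abs_re_le_norm c).trans hc
    have h4 := mul_le_of_le_one_left (norm_nonneg x) h3
    nlinarith
  refine ⟨⟨(norm_reVec_le _).trans_lt h1, (norm_imVec_le _).trans_lt h1, ?_⟩, h2⟩
  by_cases hc0 : c.im = 0
  · left; rw [imVec_wedgeDisc_ofRealVec, hc0, zero_smul]
  · exact Or.inr (h2 hc0)

theorem differentiableAt_of_eq_on_cone (hC : IsOpen C) {P : (Fin n → ℂ) → ℂ}
    (hP : ∀ z, imVec z ∈ C → P z = g z) (hgd : DifferentiableOn ℂ g (tube C δ)) {z : Fin n → ℂ}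
    (hz : z ∈ closedTube C δ) (hzC : imVec z ∈ C) : DifferentiableAt ℂ P z := by
  refine (hgd.differentiableAt ((isOpen_tube hC δ).mem_nhds
    ⟨hz.1, hz.2.1, hzC⟩)).congr_of_eventuallyEq ?_
  filter_upwards [(hC.preimage continuous_imVec).mem_nhds hzC] with w hw using hP w hw

/-- Along the disc, `P` is continuous and is holomorphic off the real diameter, so the mean value
property holds; at `c = 0` the disc is at `x` and the weight is `1`. -/
theorem wedgeAverage_ofRealVec (h : IsWedgeScale C δ κ ρ e)
    (hgd : DifferentiableOn ℂ g (tube C δ)) {P : (Fin n → ℂ) → ℂ}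
    (hP : ∀ z, imVec z ∈ C → P z = g z) (hPc : ContinuousOn P (closedTube C δ)) {x : Fin n → ℝ}
    (hx : ‖x‖ < κ * ρ / 4) : wedgeAverage κ e M g (ofRealVec x) = P (ofRealVec x) := by
  have h1 : Real.circleAverage (fun c => P (wedgeDisc κ e (ofRealVec x) c) * (1 - c ^ 2) ^ M) 0 1 =
      P (ofRealVec x) := by
    rw [circleAverage_of_off_real]
    · simp [wedgeDisc]
    · refine ContinuousOn.mul (hPc.comp (continuous_wedgeDisc _ _ _).continuousOn ?_) (by fun_prop)
      exact fun c hc => (h.mem_closedTube_of_real hx (mem_closedBall_zero_iff.1 hc)).1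
    · intro c hc hc0
      have h2 := h.mem_closedTube_of_real hx (mem_ball_zero_iff.1 hc).le
      have h3 := differentiableAt_of_eq_on_cone h.isOpenCone.isOpen hP hgd h2.1 (h2.2 hc0)
      have h4 : DifferentiableAt ℂ (wedgeDisc κ e (ofRealVec x)) c := by
        unfold wedgeDisc; fun_prop
      exact (h3.comp c h4).mul (by fun_prop)
  rw [← h1]
  simp only [wedgeAverage, Real.circleAverage_def]
  congr 1
  refine intervalIntegral.integral_congr_ae ?_
  filter_upwards [ae_im_circleMap_ne_zero _] with θ hθ _
  rw [hP _ ((h.mem_closedTube_of_real hx (by simp)).2 hθ)]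

/-- The edge of the wedge theorem for functions that are continuous up to the edge. -/
theorem wedgeAverage_eq_of_continuousOn (h : IsWedgeScale C δ κ ρ e) (hgm : Measurable g)
    (hgd : DifferentiableOn ℂ g (tube C δ)) (hg : PolynomialGrowth C δ K M g)
    {P : (Fin n → ℂ) → ℂ} (hP : ∀ z, imVec z ∈ C → P z = g z)
    (hPc : ContinuousOn P (closedTube C δ)) {w : Fin n → ℂ} (hw : ‖w‖ < κ * ρ / 16)
    (hwC : imVec w ∈ C) : wedgeAverage κ e M g w = g w := by
  have hκρ := mul_pos h.κ_pos h.ρ_pos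
  have hδ : κ * ρ / 4 < δ := by
    have := mul_nonneg h.κ_pos.le (norm_nonneg e)
    linarith [h.lt, mul_add κ ‖e‖ ρ]
  have hA := differentiableOn_wedgeAverage h hgm hgd hg
  -- The complex line through `reVec w` in direction `imVec w`: real parameters give edge points,
  -- the upper half plane is sent over the cone, and `ℓ I = w`. The parameter disc has radius `2` to
  -- contain `I`; then `‖ℓ ζ‖ < 3 * (κ * ρ / 16)`, which fits in the ball of radius `κ * ρ / 4`.
  let ℓ : ℂ → Fin n → ℂ := fun ζ => ofRealVec (reVec w) + ζ • ofRealVec (imVec w)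
  have hℓd : Differentiable ℂ ℓ := by intro ζ; simp only [ℓ]; fun_prop
  have hℓre : ∀ ζ, reVec (ℓ ζ) = reVec w + ζ.re • imVec w := fun ζ => by simp [ℓ]
  have hℓim : ∀ ζ, imVec (ℓ ζ) = ζ.im • imVec w := fun ζ => by simp [ℓ]
  have hℓ : ∀ ζ ∈ Metric.ball (0 : ℂ) 2, ‖ℓ ζ‖ < κ * ρ / 4 := by
    intro ζ hζ
    rw [mem_ball_zero_iff] at hζ
    have h1 := norm_add_le (ofRealVec (reVec w)) (ζ • ofRealVec (imVec w))
    rw [norm_smul, norm_ofRealVec, norm_ofRealVec] at h1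
    have h2 := norm_reVec_le w
    have h3 := norm_imVec_le w
    have h4 : ‖ζ‖ * ‖imVec w‖ ≤ 2 * ‖imVec w‖ := by gcongr
    simp only [ℓ]
    linarith
  have hmem : ∀ ζ ∈ Metric.ball (0 : ℂ) 2, 0 ≤ ζ.im → ℓ ζ ∈ closedTube C δ ∧
      (0 < ζ.im → imVec (ℓ ζ) ∈ C) := by
    intro ζ hζ hi
    have h1 := (hℓ ζ hζ).trans hδ
    have h2 : 0 < ζ.im → imVec (ℓ ζ) ∈ C := fun hi => by
      rw [hℓim]; exact h.isOpenCone.smul_mem _ hwC _ hi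
    refine ⟨⟨(norm_reVec_le _).trans_lt h1, (norm_imVec_le _).trans_lt h1, ?_⟩, h2⟩
    rcases hi.eq_or_lt with h0 | h0
    · left; rw [hℓim, ← h0, zero_smul]
    · exact Or.inr (h2 h0)
  have hzero := eq_zero_of_eq_zero_on_real (r := 2)
    (g := fun ζ => wedgeAverage κ e M g (ℓ ζ) - P (ℓ ζ)) ?_ ?_ ?_ Complex.I (by simp) (by simp)
  · have hI : ℓ Complex.I = w := by
      rw [← toComplex_reVec_imVec (ℓ Complex.I), hℓre, hℓim]; simp
    simp only [hI] at hzero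
    rw [sub_eq_zero.1 hzero, hP w hwC]
  · refine ContinuousOn.sub (hA.continuousOn.comp hℓd.continuous.continuousOn ?_)
      (hPc.comp hℓd.continuous.continuousOn ?_)
    · exact fun ζ hζ => mem_ball_zero_iff.2 (hℓ ζ hζ.1)
    · exact fun ζ hζ => (hmem ζ hζ.1 hζ.2).1
  · intro ζ hζ hi
    have h1 := hmem ζ hζ hi.le
    have h2 := differentiableAt_of_eq_on_cone h.isOpenCone.isOpen hP hgd h1.1 (h1.2 hi)
    have h3 := hA.differentiableAt (Metric.isOpen_ball.mem_nhds (mem_ball_zero_iff.2 (hℓ ζ hζ)))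
    exact (h3.comp ζ (hℓd ζ)).sub (h2.comp ζ (hℓd ζ))
  · intro ζ hζ hi
    have h1 : ℓ ζ = ofRealVec (reVec (ℓ ζ)) := by
      conv_lhs => rw [← toComplex_reVec_imVec (ℓ ζ), hℓim, hi, zero_smul, toComplex_zero_right]
    change wedgeAverage κ e M g (ℓ ζ) - P (ℓ ζ) = 0
    rw [sub_eq_zero, h1]
    exact wedgeAverage_ofRealVec h hgd hP hPc ((norm_reVec_le _).trans_lt (hℓ ζ hζ))

end WedgeAverage

/-! ### Local extension: removal of the mollification -/

section LocalExtension

variable {n : ℕ}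

theorem tendsto_mollify {f : (Fin n → ℂ) → ℂ} (hfm : Measurable f) {z : Fin n → ℂ}
    (hf : ContinuousAt f z) {φ : ℕ → ContDiffBump (0 : Fin n → ℝ)}
    (hφ : Tendsto (fun k => (φ k).rOut) atTop (𝓝 0)) :
    Tendsto (fun k => mollify ((φ k).normed volume) f z) atTop (𝓝 (f z)) := by
  rw [Metric.tendsto_nhds]
  intro ε hε
  obtain ⟨η, hη, hηf⟩ := Metric.continuousAt_iff.1 hf (ε / 2) (half_pos hε)
  filter_upwards [hφ.eventually (gt_mem_nhds hη)] with k hk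
  have hmeas : Measurable fun s : Fin n → ℝ => f (z - ofRealVec s) :=
    hfm.comp (Continuous.measurable (by fun_prop))
  have h := (φ k).dist_normed_convolution_le (μ := volume) (x₀ := 0) (ε := ε / 2)
    (g := fun s : Fin n → ℝ => f (z - ofRealVec s)) hmeas.aestronglyMeasurable (by
      intro s hs
      have h0 : ofRealVec (0 : Fin n → ℝ) = 0 := by ext j; simp [ofRealVec]
      rw [h0, sub_zero]
      refine (hηf ?_).le
      rw [dist_eq_norm, sub_sub_cancel_left, norm_neg, norm_ofRealVec]
      exact (mem_ball_zero_iff.1 hs).trans hk)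
  have h0 : ofRealVec (0 : Fin n → ℝ) = 0 := by ext j; simp [ofRealVec]
  have h1 : ∀ t : Fin n → ℝ, z - ofRealVec (0 - t) = z + ofRealVec t := fun t => by
    ext j; simp [ofRealVec]
  rw [MeasureTheory.convolution_def, h0, sub_zero] at h
  simp only [h1, ContinuousLinearMap.lsmul_apply, Complex.real_smul] at h
  exact h.trans_lt (half_lt_self hε)

/-- The edge of the wedge theorem near a point. -/
theorem exists_local_extension {C : Set (Fin n → ℝ)} (hC : IsOpenCone C)
    (hsymm : ∀ y, y ∈ C ↔ -y ∈ C) (hne : C.Nonempty) (h0 : (0 : Fin n → ℝ) ∉ C) {R : ℝ}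
    (hR : 0 < R) {f : (Fin n → ℂ) → ℂ} (hfm : Measurable f)
    (hf : DifferentiableOn ℂ f (tube C R)) (hlim : HasLocalLimit C R f) :
    ∃ r > 0, ∃ h : (Fin n → ℂ) → ℂ, DifferentiableOn ℂ h (Metric.ball 0 r) ∧
      ∀ z ∈ Metric.ball 0 r, imVec z ∈ C → h z = f z := by
  obtain ⟨δ₁, hδ₁, hδ₁R, K, hK, M, hgrowth⟩ := exists_polynomial_growth hR hf hlim
  obtain ⟨δ₂, hδ₂, hδ₂R, hext⟩ := exists_continuous_extension hC hne h0 hR hfm hf hlim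
  obtain ⟨e, he⟩ := hne
  obtain ⟨ρ, hρ, hball⟩ := Metric.isOpen_iff.1 hC.isOpen e he
  -- Half of `δ₁` is reserved for the mollification radii, which are at most `δ₁ / 2`.
  set δ := min (δ₁ / 2) δ₂ with hδdef
  have hδ : 0 < δ := by positivity
  have hδ1 : δ ≤ δ₁ / 2 := min_le_left _ _
  have hδ2 : δ ≤ δ₂ := min_le_right _ _
  set κ := δ / (2 * (‖e‖ + ρ)) with hκdef
  have hsum : 0 < ‖e‖ + ρ := by positivity
  have hκ : 0 < κ := by positivity
  have hscale : IsWedgeScale C δ κ ρ e := by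
    refine ⟨hC, hsymm, hball, hκ, hρ, ?_⟩
    have : κ * (‖e‖ + ρ) = δ / 2 := by rw [hκdef]; field_simp
    linarith
  have hfg : PolynomialGrowth C δ K M f := hgrowth.mono (by linarith)
  have hfd : DifferentiableOn ℂ f (tube C δ) := hf.mono (tube_mono C (by linarith))
  refine ⟨κ * ρ / 16, by positivity, wedgeAverage κ e M f,
    (differentiableOn_wedgeAverage hscale hfm hfd hfg).mono
      (Metric.ball_subset_ball (by linarith [mul_pos hκ hρ])), ?_⟩
  intro w hw hwC
  rw [mem_ball_zero_iff] at hw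
  have hwδ : ‖w‖ < δ := by
    have := mul_nonneg hκ.le (norm_nonneg e)
    have := mul_pos hκ hρ
    linarith [hscale.lt, mul_add κ ‖e‖ ρ]
  have hε : ∀ k : ℕ, 0 < δ₁ / 2 * (1 / ((k : ℝ) + 1)) := fun k => by positivity
  let φ : ℕ → ContDiffBump (0 : Fin n → ℝ) := fun k =>
    ⟨δ₁ / 2 * (1 / ((k : ℝ) + 1)) / 2, δ₁ / 2 * (1 / ((k : ℝ) + 1)), half_pos (hε k),
      half_lt_self (hε k)⟩
  have hφ0 : Tendsto (fun k => (φ k).rOut) atTop (𝓝 0) := by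
    have := (tendsto_one_div_add_atTop_nhds_zero_nat (𝕜 := ℝ)).const_mul (δ₁ / 2)
    rwa [mul_zero] at this
  have hφle : ∀ k, (φ k).rOut ≤ δ₁ / 2 := by
    intro k
    refine mul_le_of_le_one_right (by positivity) ?_
    rw [div_le_one (by positivity)]
    linarith [(Nat.cast_nonneg k : (0 : ℝ) ≤ k)]
  have hsupp : ∀ k, Function.support ((φ k).normed volume) ⊆
      Metric.closedBall (0 : Fin n → ℝ) (φ k).rOut := fun k => by
    rw [(φ k).support_normed_eq]; exact Metric.ball_subset_closedBall
  have hcont : ∀ k, Continuous ((φ k).normed (volume : Measure (Fin n → ℝ))) := fun k =>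
    (φ k).continuous_normed
  have hGm : ∀ k, Measurable (mollify ((φ k).normed volume) f) := fun k =>
    measurable_mollify (hcont k) hfm
  have hGg : ∀ k, PolynomialGrowth C δ K M (mollify ((φ k).normed volume) f) := fun k =>
    (hgrowth.mollify (hcont k) (hsupp k) (φ k).rOut_pos.le (φ k).nonneg_normed
      (φ k).integral_normed).mono (by linarith [hφle k])
  have hGd : ∀ k, DifferentiableOn ℂ (mollify ((φ k).normed volume) f) (tube C δ) := fun k =>
    (differentiableOn_mollify hC.isOpen (hcont k) (hsupp k) hfm hf).mono
      (tube_mono C (by linarith [hφle k]))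
  have hG : ∀ k, wedgeAverage κ e M (mollify ((φ k).normed volume) f) w =
      mollify ((φ k).normed volume) f w := by
    intro k
    obtain ⟨P, hP, hPc⟩ := hext _ (φ k).contDiff_normed
      ((hsupp k).trans (Metric.closedBall_subset_closedBall (by linarith [hφle k])))
    refine wedgeAverage_eq_of_continuousOn hscale (hGm k) (hGd k) (hGg k) hP
      (hPc.mono fun z hz => ⟨hz.1.trans_le hδ2, hz.2.1.trans_le hδ2, hz.2.2⟩) hw hwC
  have hpt : ∀ z ∈ tube C δ,
      Tendsto (fun k => mollify ((φ k).normed volume) f z) atTop (𝓝 (f z)) := fun z hz =>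
    tendsto_mollify hfm (hfd.continuousOn.continuousAt ((isOpen_tube hC.isOpen δ).mem_nhds hz)) hφ0
  have h1 := tendsto_wedgeAverage hscale hGm hGg hpt (w := w) (by linarith [mul_pos hκ hρ])
  simp only [hG] at h1
  exact tendsto_nhds_unique h1 (hpt w
    ⟨(norm_reVec_le _).trans_lt hwδ, (norm_imVec_le _).trans_lt hwδ, hwC⟩)

end LocalExtension

/-! ### Translation to real points and gluing -/

section Gluing

variable {n : ℕ}

theorem ofRealVec_sub (x y : Fin n → ℝ) : ofRealVec (x - y) = ofRealVec x - ofRealVec y := by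
  ext j; simp [ofRealVec]

/-- A boundary value in the sense of distributions induces local limits around every point. -/
theorem HasDistribBoundaryValue.hasLocalLimit {E : Opens (Fin n → ℝ)} {C : Set (Fin n → ℝ)}
    {f : (Fin n → ℂ) → ℂ} {u : 𝓓'(E, ℂ)} (h : HasDistribBoundaryValue E C f u)
    {a : Fin n → ℝ} {R : ℝ} (hR : 0 < R) (ha : Metric.ball a R ⊆ (E : Set (Fin n → ℝ))) :
    HasLocalLimit C R ((tube C R).indicator fun z => f (z + ofRealVec a)) := by
  intro R' hR' φ hφ hs
  have hts : tsupport (fun x => φ (x - a)) ⊆ Metric.closedBall a R' := by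
    refine closure_minimal (fun x hx => ?_) Metric.isClosed_closedBall
    have := mem_closedBall_zero_iff.1 (hs hx)
    rwa [mem_closedBall_iff_norm]
  let Φ : 𝓓(E, ℝ) :=
    { toFun := fun x => φ (x - a)
      contDiff' := hφ.comp (by fun_prop)
      hasCompactSupport' := HasCompactSupport.of_support_subset_isCompact
        (isCompact_closedBall a R') ((subset_tsupport _).trans hts)
      tsupport_subset' := (hts.trans (Metric.closedBall_subset_ball hR')).trans ha }
  refine ⟨u Φ, (h Φ).congr' ?_⟩
  filter_upwards [self_mem_nhdsWithin, nhdsWithin_le_nhds (Metric.ball_mem_nhds _ hR)]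
    with Y hY hYR
  rw [mem_ball_zero_iff] at hYR
  change ∫ x, (φ (x - a) : ℂ) * f (toComplex x Y) = _
  rw [← integral_add_right_eq_self (fun x => (φ (x - a) : ℂ) * f (toComplex x Y)) a]
  congr 1; ext x
  rw [add_sub_cancel_right]
  by_cases hx : φ x = 0
  · simp [hx]
  · have hxR := (mem_closedBall_zero_iff.1 (hs hx)).trans_lt hR'
    rw [indicator_of_mem (show toComplex x Y ∈ tube C R from
      ⟨by simpa using hxR, by simpa using hYR, by simpa using hY⟩), add_ofRealVec]
    simp

/-- The point `a` is translated to the origin. Cutting `f` off outside the tube makes it measurable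
on all of `ℂⁿ`, since nothing is known of `f` outside its domain. -/
theorem exists_extension_near {E : Opens (Fin n → ℝ)} {C : Set (Fin n → ℝ)} (hC : IsOpenCone C)
    (hsymm : ∀ y, y ∈ C ↔ -y ∈ C) (hne : C.Nonempty) (h0 : (0 : Fin n → ℝ) ∉ C)
    {N : Set (Fin n → ℂ)} (hN : IsOpen N) {f : (Fin n → ℂ) → ℂ}
    (hf : DifferentiableOn ℂ f (N ∩ wedge (E : Set (Fin n → ℝ)) C)) {u : 𝓓'(E, ℂ)}
    (hu : HasDistribBoundaryValue E C f u) {a : Fin n → ℝ} (haE : a ∈ E)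
    (haN : ofRealVec a ∈ N) :
    ∃ r > 0, ∃ h : (Fin n → ℂ) → ℂ, Metric.ball (ofRealVec a) r ⊆ N ∧
      DifferentiableOn ℂ h (Metric.ball (ofRealVec a) r) ∧
      ∀ z ∈ Metric.ball (ofRealVec a) r, imVec z ∈ C → h z = f z := by
  obtain ⟨s₁, hs₁, hsN⟩ := Metric.isOpen_iff.1 hN _ haN
  obtain ⟨s₂, hs₂, hsE⟩ := Metric.isOpen_iff.1 E.isOpen _ haE
  set R := min (s₁ / 2) s₂ with hRdef
  have hR : 0 < R := by positivity
  have hR1 : R ≤ s₁ / 2 := min_le_left _ _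
  have hR2 : R ≤ s₂ := min_le_right _ _
  have hopen := isOpen_tube hC.isOpen R
  have hmaps : MapsTo (fun z => z + ofRealVec a) (tube C R)
      (N ∩ wedge (E : Set (Fin n → ℝ)) C) := by
    intro z hz
    refine ⟨hsN ?_, mem_wedge_iff.2 ⟨hsE ?_, ?_⟩⟩
    · rw [mem_ball_iff_norm, add_sub_cancel_right]
      have := norm_toComplex_le (reVec z) (imVec z)
      rw [toComplex_reVec_imVec] at this
      linarith [hz.1, hz.2.1]
    · rw [mem_ball_iff_norm, reVec_add, reVec_ofRealVec, add_sub_cancel_right]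
      exact hz.1.trans_le hR2
    · rw [imVec_add, imVec_ofRealVec, add_zero]; exact hz.2.2
  have hd : DifferentiableOn ℂ (fun z => f (z + ofRealVec a)) (tube C R) :=
    hf.comp (by fun_prop) hmaps
  have hd' : DifferentiableOn ℂ ((tube C R).indicator fun z => f (z + ofRealVec a)) (tube C R) :=
    hd.congr fun z hz => indicator_of_mem hz _
  have hmeas : Measurable ((tube C R).indicator fun z => f (z + ofRealVec a)) := by
    classical
    rw [← piecewise_eq_indicator]
    exact hd.continuousOn.measurable_piecewise continuousOn_const hopen.measurableSet
  obtain ⟨r, hr, h, hh, heq⟩ := exists_local_extension hC hsymm hne h0 hR hmeas hd'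
    (hu.hasLocalLimit hR ((Metric.ball_subset_ball hR2).trans hsE))
  have hsub : ∀ z ∈ Metric.ball (ofRealVec a) (min r R), z - ofRealVec a ∈ Metric.ball 0 r := by
    intro z hz
    rw [mem_ball_zero_iff]
    exact (mem_ball_iff_norm.1 hz).trans_le (min_le_left _ _)
  refine ⟨min r R, by positivity, fun z => h (z - ofRealVec a), ?_,
    hh.comp (by fun_prop) hsub, ?_⟩
  · exact (Metric.ball_subset_ball ((min_le_right _ _).trans (by linarith))).trans hsN
  · intro z hz hzC
    have hzn := (mem_ball_iff_norm.1 hz).trans_le (min_le_right _ _)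
    have him : imVec (z - ofRealVec a) = imVec z := by simp
    have hmem : z - ofRealVec a ∈ tube C R :=
      ⟨(norm_reVec_le _).trans_lt hzn, (norm_imVec_le _).trans_lt hzn, him ▸ hzC⟩
    change h (z - ofRealVec a) = f z
    rw [heq _ (hsub z hz) (him ▸ hzC), indicator_of_mem hmem, sub_add_cancel]

/-- The identity theorem on convex open subsets of a complex normed space. -/
theorem eq_of_eventuallyEq_of_convex {H : Type*} [NormedAddCommGroup H] [NormedSpace ℂ H]
    {U : Set H} (hU : IsOpen U) (hconv : Convex ℝ U) {g h : H → ℂ} (hg : DifferentiableOn ℂ g U)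
    (hh : DifferentiableOn ℂ h U) {p w : H} (hp : p ∈ U) (hw : w ∈ U) (heq : g =ᶠ[𝓝 p] h) :
    g w = h w := by
  -- On the complex line through `p` and `w`, convexity of `U` gives a connected planar domain,
  -- where the one-variable identity theorem applies.
  let ℓ : ℂ → H := fun ζ => p + ζ • (w - p)
  have hℓ : Differentiable ℂ ℓ := by intro ζ; simp only [ℓ]; fun_prop
  have hopen : IsOpen (ℓ ⁻¹' U) := hU.preimage hℓ.continuous
  have hc : Convex ℝ (ℓ ⁻¹' U) := by
    intro x hx y hy a b ha hb hab
    have h1 := hconv hx hy ha hb hab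
    have h2 : a • ℓ x + b • ℓ y = (a • p + b • p) + (a • x + b • y) • (w - p) := by
      simp only [ℓ, add_smul, smul_add, smul_assoc]
      abel
    rw [← add_smul, hab, one_smul] at h2
    change ℓ (a • x + b • y) ∈ U
    rw [h2] at h1
    exact h1
  have h0 : ℓ 0 = p := by simp [ℓ]
  have h1 : ℓ 1 = w := by simp [ℓ]
  have hev : (fun ζ => g (ℓ ζ)) =ᶠ[𝓝 0] fun ζ => h (ℓ ζ) := by
    have ht : Tendsto ℓ (𝓝 0) (𝓝 p) := h0 ▸ hℓ.continuous.tendsto 0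
    exact ht.eventually heq
  have := (((hg.comp hℓ.differentiableOn (mapsTo_preimage _ _)).analyticOnNhd
    hopen).eqOn_of_preconnected_of_eventuallyEq
    ((hh.comp hℓ.differentiableOn (mapsTo_preimage _ _)).analyticOnNhd hopen)
    hc.isPreconnected (by rw [mem_preimage, h0]; exact hp) hev)
    (show (1 : ℂ) ∈ ℓ ⁻¹' U by rw [mem_preimage, h1]; exact hw)
  simpa only [Function.comp_apply, h1] using this

/-- Two extensions of `f` to balls with real centres agree on the intersection of the balls. -/
theorem extensions_agree {C : Set (Fin n → ℝ)} (hC : IsOpenCone C) (hne : C.Nonempty)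
    {f g h : (Fin n → ℂ) → ℂ} {a b : Fin n → ℝ} {r s : ℝ}
    (hg : DifferentiableOn ℂ g (Metric.ball (ofRealVec a) r))
    (hh : DifferentiableOn ℂ h (Metric.ball (ofRealVec b) s))
    (hgf : ∀ z ∈ Metric.ball (ofRealVec a) r, imVec z ∈ C → g z = f z)
    (hhf : ∀ z ∈ Metric.ball (ofRealVec b) s, imVec z ∈ C → h z = f z) {w : Fin n → ℂ}
    (hwa : w ∈ Metric.ball (ofRealVec a) r) (hwb : w ∈ Metric.ball (ofRealVec b) s) :
    g w = h w := by
  set U := Metric.ball (ofRealVec a) r ∩ Metric.ball (ofRealVec b) s with hU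
  have hUo : IsOpen U := Metric.isOpen_ball.inter Metric.isOpen_ball
  have hUc : Convex ℝ U := (convex_ball _ _).inter (convex_ball _ _)
  -- Passing to the real part does not increase the distance to a real centre. The intersection of
  -- the balls therefore contains a real point, and near it points over `C`, where both extensions
  -- equal `f`.
  have hreal : ∀ (c : Fin n → ℝ) (t : ℝ), w ∈ Metric.ball (ofRealVec c) t →
      ofRealVec (reVec w) ∈ Metric.ball (ofRealVec c) t := by
    intro c t hw
    rw [mem_ball_iff_norm] at hw ⊢
    rw [← ofRealVec_sub, norm_ofRealVec]
    refine lt_of_le_of_lt ?_ hw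
    simpa using norm_reVec_le (w - ofRealVec c)
  have := hC.neBot hne
  have ht : Tendsto (fun Y => toComplex (reVec w) Y) (𝓝[C] 0) (𝓝 (ofRealVec (reVec w))) := by
    have h1 : Continuous fun Y : Fin n → ℝ => toComplex (reVec w) Y := by fun_prop
    have := h1.tendsto 0
    rw [toComplex_zero_right] at this
    exact this.mono_left nhdsWithin_le_nhds
  obtain ⟨Y, hYU, hYC⟩ := ((ht.eventually (hUo.mem_nhds ⟨hreal a r hwa, hreal b s hwb⟩)).and
    self_mem_nhdsWithin).exists
  refine eq_of_eventuallyEq_of_convex hUo hUc (hg.mono inter_subset_left)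
    (hh.mono inter_subset_right) hYU ⟨hwa, hwb⟩ ?_
  have hYC' : imVec (toComplex (reVec w) Y) ∈ C := by
    rw [imVec_toComplex]; exact hYC
  filter_upwards [hUo.mem_nhds hYU, (hC.isOpen.preimage continuous_imVec).mem_nhds hYC']
    with z hz hzC
  rw [hgf z hz.1 hzC, hhf z hz.2 hzC]

end Gluing

end EdgeOfWedge

/-! ### The edge of the wedge theorem -/

theorem mainTheorem3 (n : ℕ) (E : TopologicalSpace.Opens (Fin n → ℝ))
    (C : Set (Fin n → ℝ)) (hC : EdgeOfWedge.IsOpenCone C) (hCsymm : ∀ y, y ∈ C ↔ -y ∈ C)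
    (N : Set (Fin n → ℂ)) (hN : IsOpen N)
    (hNE : EdgeOfWedge.ofRealVec ⁻¹' N = (E : Set (Fin n → ℝ)))
    (f : (Fin n → ℂ) → ℂ)
    (hf : DifferentiableOn ℂ f (N ∩ EdgeOfWedge.wedge (E : Set (Fin n → ℝ)) C))
    (hbv : ∃ u : 𝓓'(E, ℂ), EdgeOfWedge.HasDistribBoundaryValue E C f u) :
    ∃ N' : Set (Fin n → ℂ), IsOpen N' ∧ N' ⊆ N ∧
      EdgeOfWedge.ofRealVec ⁻¹' N' = (E : Set (Fin n → ℝ)) ∧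
      ∃ h : (Fin n → ℂ) → ℂ, DifferentiableOn ℂ h N' ∧
        Set.EqOn h f (N' ∩ EdgeOfWedge.wedge (E : Set (Fin n → ℝ)) C) := by
  classical
  obtain ⟨u, hu⟩ := hbv
  rcases C.eq_empty_or_nonempty with rfl | hne
  · refine ⟨N, hN, subset_rfl, hNE, 0, differentiableOn_const _, ?_⟩
    rintro _ ⟨_, x, _, y, hy, _⟩
    exact hy.elim
  -- If `0 ∈ C`, the wedge is an open set that contains the edge, and `f` is its own extension.
  by_cases h0 : (0 : Fin n → ℝ) ∈ C
  · refine ⟨N ∩ EdgeOfWedge.wedge E C, hN.inter (EdgeOfWedge.isOpen_wedge E.isOpen hC.isOpen),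
      inter_subset_left, ?_, f, hf, fun _ _ => rfl⟩
    rw [preimage_inter, hNE]
    refine inter_eq_left.2 fun x hx => EdgeOfWedge.mem_wedge_iff.2 ?_
    simpa using ⟨hx, h0⟩
  have hloc : ∀ a : E, ∃ r > 0, ∃ h : (Fin n → ℂ) → ℂ,
      Metric.ball (EdgeOfWedge.ofRealVec a) r ⊆ N ∧
      DifferentiableOn ℂ h (Metric.ball (EdgeOfWedge.ofRealVec a) r) ∧
      ∀ z ∈ Metric.ball (EdgeOfWedge.ofRealVec (a : Fin n → ℝ)) r,
        EdgeOfWedge.imVec z ∈ C → h z = f z := by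
    intro a
    refine EdgeOfWedge.exists_extension_near hC hCsymm hne h0 hN hf hu a.2 ?_
    have : (a : Fin n → ℝ) ∈ EdgeOfWedge.ofRealVec ⁻¹' N := by rw [hNE]; exact a.2
    exact this
  choose r hr h hsub hd heq using hloc
  set N' : Set (Fin n → ℂ) :=
    ⋃ a : E, Metric.ball (EdgeOfWedge.ofRealVec (a : Fin n → ℝ)) (r a) with hN'
  have hN'N : N' ⊆ N := iUnion_subset hsub
  -- One value per point serves all balls that contain it; off the union the value is arbitrary.
  have hex : ∀ z : Fin n → ℂ, ∃ c : ℂ, ∀ a : E,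
      z ∈ Metric.ball (EdgeOfWedge.ofRealVec (a : Fin n → ℝ)) (r a) → c = h a z := by
    intro z
    by_cases hz : ∃ a : E, z ∈ Metric.ball (EdgeOfWedge.ofRealVec (a : Fin n → ℝ)) (r a)
    · obtain ⟨a, ha⟩ := hz
      exact ⟨h a z, fun b hb =>
        EdgeOfWedge.extensions_agree hC hne (hd a) (hd b) (heq a) (heq b) ha hb⟩
    · exact ⟨0, fun a ha => absurd ⟨a, ha⟩ hz⟩
  choose H hH using hex
  refine ⟨N', isOpen_iUnion fun _ => Metric.isOpen_ball, hN'N, ?_, H, ?_, ?_⟩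
  · refine Subset.antisymm ((preimage_mono hN'N).trans hNE.subset) fun x hx => ?_
    exact mem_iUnion.2 ⟨⟨x, hx⟩, Metric.mem_ball_self (hr _)⟩
  · intro z hz
    obtain ⟨a, ha⟩ := mem_iUnion.1 hz
    have hnhds := Metric.isOpen_ball.mem_nhds ha
    refine (((hd a).differentiableAt hnhds).congr_of_eventuallyEq ?_).differentiableWithinAt
    filter_upwards [hnhds] with w hw using hH w a hw
  · rintro z ⟨hz, hzW⟩
    obtain ⟨a, ha⟩ := mem_iUnion.1 hz
    rw [hH z a ha, heq a z ha (EdgeOfWedge.mem_wedge_iff.1 hzW).2]
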